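/- There is a function $C:\mathbb{R}\to\mathbb{R}$ such that the following holds. Let $(M,g)$ be a complete noncompact smooth Riemannian manifold (without boundary, of any dimension), with Riemannian volume measure $dv$, and let $f:M\to\mathbb{R}$ be a proper $C^\infty$ function such that, at every point of $M$, $$|\nabla f|^2\le f\qquad\text{and}\qquad \Delta f-|\nabla f|^2+f\le k$$ for some constant $k\in\mathbb{R}$, where $\nabla f$ is the gradient and $\Delta f=\operatorname{div}\nabla f$ the Laplace–Beltrami operator of $g$ (so that in particular $f\ge 0$). For $r\in\mathbb{R}$ put $D_r=\{x\in M: 2\sqrt{f(x)}<r\}$. Then $\int_M e^{-f}\,dv<\infty$, and $$\operatorname{Vol}(D_r)\le C\Big(\int_M e^{-f}\,dv\Big)\, r^{2k}\qquad\text{for all } r\ge 1.$$ Thus the constant depends only on the number $\int_M e^{-f}\,dv$, and not otherwise on $M$, $g$, $f$, $k$ or the dimension. -/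

import Mathlib

open MeasureTheory Bundle
open scoped Manifold ContDiff ENNReal

noncomputable section

namespace RiemannianVolumeGrowth

section

variable {n : ℕ} {M : Type*} [TopologicalSpace M] [ChartedSpace (EuclideanSpace ℝ (Fin n)) M]

instance instFiniteDimensionalTangent (x : M) : FiniteDimensional ℝ (TangentSpace (𝓡 n) x) :=
  inferInstanceAs (FiniteDimensional ℝ (EuclideanSpace ℝ (Fin n)))

variable [RiemannianBundle (fun x : M => TangentSpace (𝓡 n) x)]

instance instCompleteTangent (x : M) : CompleteSpace (TangentSpace (𝓡 n) x) :=
  FiniteDimensional.complete ℝ (TangentSpace (𝓡 n) x)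

/-- The Riemannian gradient of `f` at `x`: the tangent vector `∇f(x)` with
`⟨∇f(x), v⟩ = df_x(v)` for all `v`. -/
def grad (f : M → ℝ) (x : M) : TangentSpace (𝓡 n) x :=
  (InnerProductSpace.toDual ℝ (TangentSpace (𝓡 n) x)).symm (mvfderiv (𝓡 n) f x)

/-- The `i`-th coordinate vector `e_i` of `ℝⁿ`. -/
def stdVec (n : ℕ) (i : Fin n) : EuclideanSpace ℝ (Fin n) := EuclideanSpace.single i 1

/-- The `i`-th coordinate vector field `∂_i` of the chart `φ` at `c`, at the point `φ⁻¹ y`. -/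
def coordVec (c : M) (y : EuclideanSpace ℝ (Fin n)) (i : Fin n) :
    TangentSpace (𝓡 n) ((extChartAt (𝓡 n) c).symm y) :=
  mfderiv (𝓡 n) (𝓡 n) (extChartAt (𝓡 n) c).symm y (stdVec n i)

/-- The matrix `g_ij = ⟨∂_i, ∂_j⟩` of the metric in the chart at `c`, at the point with
coordinates `y`. -/
def metricMatrix (c : M) (y : EuclideanSpace ℝ (Fin n)) : Matrix (Fin n) (Fin n) ℝ :=
  Matrix.of fun i j => inner ℝ (coordVec c y i) (coordVec c y j)

/-- The volume density `√(det g_ij)` in the chart at `c`. -/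
def volDensity (c : M) (y : EuclideanSpace ℝ (Fin n)) : ℝ :=
  √(metricMatrix c y).det

/-- The `i`-th component `X^i` of the vector field `X` in the chart at `c`, as a function of the
coordinates `y`. -/
def chartComponent (c : M) (X : ∀ x : M, TangentSpace (𝓡 n) x) (i : Fin n)
    (y : EuclideanSpace ℝ (Fin n)) : ℝ :=
  (show EuclideanSpace ℝ (Fin n) from
    mfderiv (𝓡 n) (𝓡 n) (extChartAt (𝓡 n) c) ((extChartAt (𝓡 n) c).symm y)
      (X ((extChartAt (𝓡 n) c).symm y))) i

/-- The divergence of `X` computed in the chart at `c`, at the point with coordinates `y`: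
`(1 / √det g) ∑ᵢ ∂ᵢ (√det g · X^i)`. -/
def chartDivergence (c : M) (X : ∀ x : M, TangentSpace (𝓡 n) x)
    (y : EuclideanSpace ℝ (Fin n)) : ℝ :=
  (volDensity c y)⁻¹ *
    ∑ i, fderiv ℝ (fun z => volDensity c z * chartComponent c X i z) y (stdVec n i)

/-- The Riemannian divergence of a vector field. The coordinate expression does not depend on the
chart; at the point `x` the preferred chart at `x` is used. -/
def divergence (X : ∀ x : M, TangentSpace (𝓡 n) x) (x : M) : ℝ :=
  chartDivergence x X (extChartAt (𝓡 n) x x)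

/-- The Laplace–Beltrami operator `Δf = div ∇f`. -/
def laplacian (f : M → ℝ) (x : M) : ℝ :=
  divergence (n := n) (fun p => grad (n := n) f p) x

variable [MeasurableSpace M]

variable (n) in
/-- The Riemannian volume in the chart `φ` at `c`: the measure `√(det g_ij) dy` on the range of
`φ`, transported to `M` by `φ⁻¹` (it is carried by the domain of `φ`). -/
def chartVolume (c : M) : Measure M :=
  ((volume.restrict (extChartAt (𝓡 n) c).target).withDensity
    fun y => ENNReal.ofReal (volDensity c y)).map (extChartAt (𝓡 n) c).symm

variable (n) in
/-- The Riemannian volume of a set `A` that lies in the domain of some chart, computed in such a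
chart; `∞` if there is no such chart. -/
def localVolume (A : Set M) : ℝ≥0∞ :=
  ⨅ (c : M) (_ : A ⊆ (extChartAt (𝓡 n) c).source), chartVolume n c A

variable (n M) in
/-- The Riemannian volume as an outer measure: the infimum of `∑ᵢ localVolume Aᵢ` over all
countable covers by sets `Aᵢ`, each in the domain of a chart. -/
def volumeOuter : OuterMeasure M :=
  OuterMeasure.boundedBy (localVolume n)

variable (n M) in
theorem le_caratheodory_volumeOuter :
    ‹MeasurableSpace M› ≤ (volumeOuter n M).caratheodory := by
  intro s hs
  refine OuterMeasure.boundedBy_caratheodory fun t => ?_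
  refine le_iInf₂ fun c hc => ?_
  rw [← measure_inter_add_sdiff t hs]
  exact add_le_add (iInf₂_le c (Set.inter_subset_left.trans hc))
    (iInf₂_le c (Set.sdiff_subset.trans hc))

variable (n M) in
/-- The Riemannian volume measure `dv` of `M`. -/
def riemannianVolume : Measure M :=
  (volumeOuter n M).toMeasure (le_caratheodory_volumeOuter n M)

end

/-- The set `D_r = {x : 2 √f(x) < r}`. -/
def sublevel {M : Type*} (f : M → ℝ) (r : ℝ) : Set M := {x | 2 * √(f x) < r}

end RiemannianVolumeGrowth

end

/-!
The volume bound follows from a monotonicity formula for the weighted volume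
`J(t) = t^{-k} ∫ η(f) e^{-f/t} dv`, `t ≥ 1`, where `η` is a smooth nonincreasing cutoff function
(`cutoff`); as `f` is proper, `η(f)` has compact support. Green's formula, applied to the test
function `ψ(f)` with `ψ(s) = η(s) e^{-s/t}`, together with `η' ≤ 0`, gives
`∫ η(f) e^{-f/t} (Δf - |∇f|²/t) dv ≥ 0`. The two hypotheses on `f` give, for `t ≥ 1`,
`Δf - |∇f|²/t ≤ k - f + (1 - 1/t) |∇f|² ≤ k - f/t`, hence `J' ≤ 0` (`integral_cutoff_mul_nonpos`)
and `∫ η(f) e^{-f/t} ≤ t^k ∫ η(f) e^{-f}` (`integral_cutoff_exp_div_le`).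

With `t = 2`, and `B` so large that `2^k e^{-B/2} ≤ 1/2`, this shows that
`∫ η(f) e^{-f} ≤ Vol {f ≤ B} + ½ ∫ η(f) e^{-f}` for every cutoff, so that `e^{-f}` is integrable
(`integrable_exp_neg`). With `t = r²`, and `e^{-f/t} ≥ e^{-1/4}` on `D_r`, it gives
`Vol(D_r) ≤ e^{1/4} r^{2k} ∫ e^{-f}` (`measure_sublevel_le`), so `C(I) = e^{1/4} I`.

Green's formula rests on the divergence theorem `∫ φ div X dv = -∫ dφ(X) dv`, for smooth `φ` with
compact support (`integral_mul_divergence`). If the support of `φ` lies in the domain of a chart,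
it is integration by parts in `ℝⁿ` (`integral_mul_chartDivergence`), since there the Riemannian
volume is `√(det g_ij) dy` (`riemannianVolume_restrict_source`, a consequence of the change of
variables formula). The right-hand side does not involve the chart, which shows that neither does
the coordinate expression of the divergence (`chartDivergence_eq`); the general case follows by a
partition of unity.
-/

namespace RiemannianVolumeGrowth

/-! ### Smoothness of inverse matrices, integrability of products -/

section General

variable {E : Type*} [NormedAddCommGroup E] [NormedSpace ℝ E] {ι : Type*} [Fintype ι]
  [DecidableEq ι]

theorem contDiffOn_det {A : E → Matrix ι ι ℝ}
    {s : Set E} (hA : ∀ i j, ContDiffOn ℝ ∞ (fun y => A y i j) s) :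
    ContDiffOn ℝ ∞ (fun y => (A y).det) s := by
  simp only [Matrix.det_apply]
  exact ContDiffOn.sum fun σ _ => (contDiffOn_prod fun i _ => hA _ _).const_smul _

theorem contDiffOn_matrix_inv {A : E → Matrix ι ι ℝ}
    {s : Set E} (hA : ∀ i j, ContDiffOn ℝ ∞ (fun y => A y i j) s)
    (h0 : ∀ y ∈ s, (A y).det ≠ 0) (i j : ι) :
    ContDiffOn ℝ ∞ (fun y => (A y)⁻¹ i j) s := by
  simp only [Matrix.inv_def, Ring.inverse_eq_inv', Matrix.smul_apply, smul_eq_mul,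
    Matrix.adjugate_apply]
  refine ((contDiffOn_det hA).inv h0).mul (contDiffOn_det fun a b => ?_)
  by_cases ha : a = j
  · subst ha
    simpa using contDiffOn_const
  · simpa [Matrix.updateRow_apply, ha] using hA a b

/-- The product of a continuous function with compact support in `T` and a function that is
continuous on `T` only is integrable. -/
theorem integrable_mul_of_tsupport_subset {X : Type*} [TopologicalSpace X] [MeasurableSpace X]
    [BorelSpace X] [SecondCountableTopology X] [T2Space X] {μ : Measure X}
    [IsLocallyFiniteMeasure μ] {u w : X → ℝ} {T : Set X}
    (hu : Continuous u) (hc : HasCompactSupport u) (hs : tsupport u ⊆ T) (hw : ContinuousOn w T) :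
    Integrable (fun y => u y * w y) μ := by
  rw [← integrableOn_iff_integrable_of_support_subset (s := tsupport u)]
  · exact (hu.continuousOn.mul (hw.mono hs)).integrableOn_compact hc
  · intro y hy
    exact subset_tsupport _ (left_ne_zero_of_mul hy)

end General

/-! ### The metric and the gradient in a chart -/

section ChartCalculus

variable {n : ℕ} {M : Type*} [TopologicalSpace M] [ChartedSpace (EuclideanSpace ℝ (Fin n)) M]

theorem sum_smul_stdVec (v : EuclideanSpace ℝ (Fin n)) : ∑ i, v i • stdVec n i = v := by
  have := (EuclideanSpace.basisFun (Fin n) ℝ).sum_repr v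
  simpa [stdVec] using this

variable [IsManifold (𝓡 n) ∞ M]

theorem isManifold_one : IsManifold (𝓡 n) 1 M := IsManifold.of_le (n := ∞) (by norm_cast)

theorem mdifferentiableAt_extChartAt_symm (c : M) {y : EuclideanSpace ℝ (Fin n)}
    (hy : y ∈ (extChartAt (𝓡 n) c).target) :
    MDifferentiableAt (𝓡 n) (𝓡 n) (extChartAt (𝓡 n) c).symm y :=
  ((contMDiffOn_extChartAt_symm (n := ∞) c).contMDiffAt
    ((isOpen_extChartAt_target c).mem_nhds hy)).mdifferentiableAt (by simp)

/-- The differential of a chart is a left inverse of the differential of its inverse. Since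
`𝓡 n` has no boundary, derivatives within `Set.range (𝓡 n)` are plain derivatives here. -/
theorem mfderiv_extChartAt_mfderiv_symm (c : M) {y : EuclideanSpace ℝ (Fin n)}
    (hy : y ∈ (extChartAt (𝓡 n) c).target) (v : EuclideanSpace ℝ (Fin n)) :
    mfderiv (𝓡 n) (𝓡 n) (extChartAt (𝓡 n) c) ((extChartAt (𝓡 n) c).symm y)
      (mfderiv (𝓡 n) (𝓡 n) (extChartAt (𝓡 n) c).symm y v) = v := by
  have := isManifold_one (n := n) (M := M)
  have h := mfderiv_extChartAt_comp_mfderivWithin_extChartAt_symm (I := 𝓡 n) hy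
  rw [modelWithCornersSelf_coe, Set.range_id, mfderivWithin_univ] at h
  exact congrArg (fun L : EuclideanSpace ℝ (Fin n) →L[ℝ] EuclideanSpace ℝ (Fin n) => L v) h

theorem mfderiv_symm_mfderiv_extChartAt (c : M) {y : EuclideanSpace ℝ (Fin n)}
    (hy : y ∈ (extChartAt (𝓡 n) c).target)
    (v : TangentSpace (𝓡 n) ((extChartAt (𝓡 n) c).symm y)) :
    mfderiv (𝓡 n) (𝓡 n) (extChartAt (𝓡 n) c).symm y
      (mfderiv (𝓡 n) (𝓡 n) (extChartAt (𝓡 n) c) ((extChartAt (𝓡 n) c).symm y) v) = v := by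
  have := isManifold_one (n := n) (M := M)
  have h := mfderivWithin_extChartAt_symm_comp_mfderiv_extChartAt (I := 𝓡 n) hy
  rw [modelWithCornersSelf_coe, Set.range_id, mfderivWithin_univ] at h
  exact congrArg (fun L : TangentSpace (𝓡 n) ((extChartAt (𝓡 n) c).symm y) →L[ℝ]
    TangentSpace (𝓡 n) ((extChartAt (𝓡 n) c).symm y) => L v) h

theorem linearIndependent_coordVec (c : M) {y : EuclideanSpace ℝ (Fin n)}
    (hy : y ∈ (extChartAt (𝓡 n) c).target) : LinearIndependent ℝ (coordVec c y) := by
  have h0 : LinearIndependent ℝ (stdVec n) := by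
    have h := (EuclideanSpace.basisFun (Fin n) ℝ).toBasis.linearIndependent
    have he : ⇑(EuclideanSpace.basisFun (Fin n) ℝ).toBasis = stdVec n := by
      ext1 i
      simp [stdVec]
    rwa [he] at h
  refine h0.map' (mfderiv (𝓡 n) (𝓡 n) (extChartAt (𝓡 n) c).symm y).toLinearMap ?_
  exact LinearMap.ker_eq_bot_of_injective
    (Function.LeftInverse.injective (mfderiv_extChartAt_mfderiv_symm c hy))

/-- A tangent vector is the combination of the coordinate fields with its components. -/
theorem sum_chartComponent_smul_coordVec (c : M) (X : ∀ x : M, TangentSpace (𝓡 n) x)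
    {y : EuclideanSpace ℝ (Fin n)} (hy : y ∈ (extChartAt (𝓡 n) c).target) :
    ∑ i, chartComponent c X i y • coordVec c y i = X ((extChartAt (𝓡 n) c).symm y) := by
  conv_rhs => rw [← mfderiv_symm_mfderiv_extChartAt c hy (X ((extChartAt (𝓡 n) c).symm y))]
  have h := sum_smul_stdVec (n := n) (mfderiv (𝓡 n) (𝓡 n) (extChartAt (𝓡 n) c)
    ((extChartAt (𝓡 n) c).symm y) (X ((extChartAt (𝓡 n) c).symm y)))
  conv_rhs => rw [← h]
  erw [map_sum]
  refine Finset.sum_congr rfl fun i _ => ?_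
  erw [map_smul]
  rfl

theorem mvfderiv_coordVec (c : M) {φ : M → ℝ} {y : EuclideanSpace ℝ (Fin n)}
    (hy : y ∈ (extChartAt (𝓡 n) c).target)
    (hφ : MDifferentiableAt (𝓡 n) 𝓘(ℝ, ℝ) φ ((extChartAt (𝓡 n) c).symm y)) (i : Fin n) :
    mvfderiv (𝓡 n) φ ((extChartAt (𝓡 n) c).symm y) (coordVec c y i) =
      fderiv ℝ (φ ∘ (extChartAt (𝓡 n) c).symm) y (stdVec n i) := by
  have h := mvfderiv_comp_apply (I := 𝓡 n) (I' := 𝓡 n) y hφ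
    (mdifferentiableAt_extChartAt_symm c hy) (stdVec n i)
  refine h.symm.trans ?_
  simp only [mvfderiv]
  rw [mfderiv_eq_fderiv]
  rfl

/-- In a chart, `dφ(X) = ∑ᵢ Xⁱ ∂ᵢφ`. -/
theorem mvfderiv_apply_eq_sum (c : M) {φ : M → ℝ} (X : ∀ x : M, TangentSpace (𝓡 n) x)
    {y : EuclideanSpace ℝ (Fin n)} (hy : y ∈ (extChartAt (𝓡 n) c).target)
    (hφ : MDifferentiableAt (𝓡 n) 𝓘(ℝ, ℝ) φ ((extChartAt (𝓡 n) c).symm y)) :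
    mvfderiv (𝓡 n) φ ((extChartAt (𝓡 n) c).symm y) (X ((extChartAt (𝓡 n) c).symm y)) =
      ∑ i, chartComponent c X i y *
        fderiv ℝ (φ ∘ (extChartAt (𝓡 n) c).symm) y (stdVec n i) := by
  rw [← sum_chartComponent_smul_coordVec c X hy, map_sum]
  refine Finset.sum_congr rfl fun i _ => ?_
  rw [map_smul, mvfderiv_coordVec c hy hφ, smul_eq_mul]

/-- The coordinate fields are smooth: in the trivialization of the tangent bundle at `c`, which is
the differential of the chart, they are constant. -/
theorem contMDiffOn_coordVec (c : M) (i : Fin n) :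
    ContMDiffOn (𝓡 n) (𝓡 n).tangent ∞
      (fun y => (⟨(extChartAt (𝓡 n) c).symm y, coordVec c y i⟩ : TangentBundle (𝓡 n) M))
      (extChartAt (𝓡 n) c).target := by
  have h1 := isManifold_one (n := n) (M := M)
  have hs := contMDiffOn_extChartAt_symm (I := 𝓡 n) (n := ∞) c
  rw [Trivialization.contMDiffOn_iff (e := trivializationAt (EuclideanSpace ℝ (Fin n))
    (TangentSpace (𝓡 n)) c)]
  · refine ⟨hs, ?_⟩
    refine (contMDiffOn_const (c := stdVec n i)).congr fun y hy => ?_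
    have hx : (extChartAt (𝓡 n) c).symm y ∈ (chartAt (EuclideanSpace ℝ (Fin n)) c).source := by
      have := (extChartAt (𝓡 n) c).map_target hy
      rwa [extChartAt_source] at this
    have hc : ∀ v : TangentSpace (𝓡 n) ((extChartAt (𝓡 n) c).symm y),
        (trivializationAt (EuclideanSpace ℝ (Fin n)) (TangentSpace (𝓡 n)) c).continuousLinearMapAt
          ℝ ((extChartAt (𝓡 n) c).symm y) v =
        (trivializationAt (EuclideanSpace ℝ (Fin n)) (TangentSpace (𝓡 n)) c
          ⟨(extChartAt (𝓡 n) c).symm y, v⟩).2 := fun v => by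
      rw [Trivialization.continuousLinearMapAt_apply, Trivialization.linearMapAt_apply]
      exact if_pos hx
    refine (hc _).symm.trans ?_
    rw [TangentBundle.continuousLinearMapAt_trivializationAt (I := 𝓡 n) hx]
    exact mfderiv_extChartAt_mfderiv_symm c hy (stdVec n i)
  · intro y hy
    have := (extChartAt (𝓡 n) c).map_target hy
    rw [extChartAt_source] at this
    simpa [Trivialization.mem_source] using this

section Metric

variable [RiemannianBundle (fun x : M => TangentSpace (𝓡 n) x)]

omit [IsManifold (𝓡 n) ∞ M] in
theorem inner_grad (f : M → ℝ) (x : M) (v : TangentSpace (𝓡 n) x) :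
    inner ℝ (grad (n := n) f x) v = mvfderiv (𝓡 n) f x v := by
  rw [grad, InnerProductSpace.toDual_symm_apply]

theorem posDef_metricMatrix (c : M) {y : EuclideanSpace ℝ (Fin n)}
    (hy : y ∈ (extChartAt (𝓡 n) c).target) : (metricMatrix c y).PosDef :=
  Matrix.posDef_gram_of_linearIndependent (𝕜 := ℝ) (linearIndependent_coordVec c hy)

theorem volDensity_pos (c : M) {y : EuclideanSpace ℝ (Fin n)}
    (hy : y ∈ (extChartAt (𝓡 n) c).target) : 0 < volDensity c y :=
  Real.sqrt_pos.2 (posDef_metricMatrix c hy).det_pos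

variable [IsContMDiffRiemannianBundle (𝓡 n) ∞ (EuclideanSpace ℝ (Fin n))
  (fun x : M => TangentSpace (𝓡 n) x)]

theorem contDiffOn_metricMatrix (c : M) (i j : Fin n) :
    ContDiffOn ℝ ∞ (fun y => metricMatrix c y i j) (extChartAt (𝓡 n) c).target := by
  rw [← contMDiffOn_iff_contDiffOn]
  exact (contMDiffOn_coordVec c i).inner_bundle (contMDiffOn_coordVec c j)

theorem contDiffOn_volDensity (c : M) :
    ContDiffOn ℝ ∞ (volDensity (n := n) c) (extChartAt (𝓡 n) c).target :=
  (contDiffOn_det (contDiffOn_metricMatrix c)).sqrt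
    fun _ hy => (posDef_metricMatrix c hy).det_pos.ne'

omit [IsContMDiffRiemannianBundle (𝓡 n) ∞ (EuclideanSpace ℝ (Fin n))
  (fun x : M => TangentSpace (𝓡 n) x)] in
/-- In a chart, `∑ⱼ g_ij (∇f)ʲ = ∂ᵢf`. -/
theorem metricMatrix_mulVec_grad (c : M) {f : M → ℝ} (hf : ContMDiff (𝓡 n) 𝓘(ℝ, ℝ) ∞ f)
    {y : EuclideanSpace ℝ (Fin n)} (hy : y ∈ (extChartAt (𝓡 n) c).target) :
    (metricMatrix c y).mulVec (fun j => chartComponent c (grad (n := n) f) j y) =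
      fun i => fderiv ℝ (f ∘ (extChartAt (𝓡 n) c).symm) y (stdVec n i) := by
  ext i
  rw [← mvfderiv_coordVec c hy ((hf _).mdifferentiableAt (by simp)), ← inner_grad,
    ← sum_chartComponent_smul_coordVec c (grad (n := n) f) hy, sum_inner]
  simp only [Matrix.mulVec, dotProduct]
  refine Finset.sum_congr rfl fun j _ => ?_
  rw [real_inner_smul_left, real_inner_comm, mul_comm]
  rfl

/-- The gradient has smooth components: they are `∑ⱼ gⁱʲ ∂ⱼf`. -/
theorem contDiffOn_chartComponent_grad (c : M) {f : M → ℝ} (hf : ContMDiff (𝓡 n) 𝓘(ℝ, ℝ) ∞ f)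
    (i : Fin n) :
    ContDiffOn ℝ ∞ (chartComponent c (grad (n := n) f) i) (extChartAt (𝓡 n) c).target := by
  have hd : ∀ y ∈ (extChartAt (𝓡 n) c).target, (metricMatrix c y).det ≠ 0 :=
    fun y hy => (posDef_metricMatrix c hy).det_pos.ne'
  have hfs : ContDiffOn ℝ ∞ (f ∘ (extChartAt (𝓡 n) c).symm) (extChartAt (𝓡 n) c).target :=
    contMDiffOn_iff_contDiffOn.1
      (hf.comp_contMDiffOn (contMDiffOn_extChartAt_symm (n := ∞) c))
  have hdf : ContDiffOn ℝ ∞ (fderiv ℝ (f ∘ (extChartAt (𝓡 n) c).symm))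
      (extChartAt (𝓡 n) c).target :=
    hfs.fderiv_of_isOpen (isOpen_extChartAt_target c) (by simp)
  have key : ContDiffOn ℝ ∞ (fun y => ∑ j, (metricMatrix c y)⁻¹ i j *
      fderiv ℝ (f ∘ (extChartAt (𝓡 n) c).symm) y (stdVec n j)) (extChartAt (𝓡 n) c).target :=
    ContDiffOn.sum fun j _ =>
      (contDiffOn_matrix_inv (contDiffOn_metricMatrix c) hd i j).mul
        (hdf.clm_apply contDiffOn_const)
  refine key.congr fun y hy => ?_
  have h := congrArg ((metricMatrix c y)⁻¹.mulVec) (metricMatrix_mulVec_grad c hf hy)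
  rw [Matrix.mulVec_mulVec, Matrix.nonsing_inv_mul _ (isUnit_iff_ne_zero.2 (hd y hy)),
    Matrix.one_mulVec] at h
  exact congrFun h i

end Metric
end ChartCalculus

/-! ### The Riemannian volume in a chart -/

section Volume

variable {n : ℕ} {M : Type*} [TopologicalSpace M] [ChartedSpace (EuclideanSpace ℝ (Fin n)) M]
  [IsManifold (𝓡 n) ∞ M] [RiemannianBundle (fun x : M => TangentSpace (𝓡 n) x)]

/-- The inner product of two tangent vectors at `x`, computed from their components in the chart at
`c`. Stating it at a point of `M`, not at a point of the target, avoids transporting tangent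
vectors along `φ⁻¹ (φ x) = x` when two charts are compared. -/
theorem inner_eq_metricMatrix (c : M) {x : M} (hx : x ∈ (extChartAt (𝓡 n) c).source)
    (v w : TangentSpace (𝓡 n) x) :
    inner ℝ v w = ∑ a, ∑ b, metricMatrix c (extChartAt (𝓡 n) c x) a b *
      ((show EuclideanSpace ℝ (Fin n) from mfderiv (𝓡 n) (𝓡 n) (extChartAt (𝓡 n) c) x v) a *
       (show EuclideanSpace ℝ (Fin n) from mfderiv (𝓡 n) (𝓡 n) (extChartAt (𝓡 n) c) x w) b) := by
  obtain ⟨y, hy, rfl⟩ : ∃ y ∈ (extChartAt (𝓡 n) c).target, (extChartAt (𝓡 n) c).symm y = x :=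
    ⟨_, (extChartAt (𝓡 n) c).map_source hx, (extChartAt (𝓡 n) c).left_inv hx⟩
  rw [(extChartAt (𝓡 n) c).right_inv hy]
  have key : ∀ u : TangentSpace (𝓡 n) ((extChartAt (𝓡 n) c).symm y),
      u = ∑ i, (show EuclideanSpace ℝ (Fin n) from mfderiv (𝓡 n) (𝓡 n) (extChartAt (𝓡 n) c)
        ((extChartAt (𝓡 n) c).symm y) u) i • coordVec c y i := fun u => by
    classical
    have h := sum_chartComponent_smul_coordVec c
      (Function.update (fun x : M => (0 : TangentSpace (𝓡 n) x)) _ u) hy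
    rw [Function.update_self] at h
    refine h.symm.trans (Finset.sum_congr rfl fun i _ => ?_)
    rw [chartComponent, Function.update_self]
  conv_lhs => rw [key v, key w]
  rw [sum_inner]
  refine Finset.sum_congr rfl fun a _ => ?_
  rw [inner_sum]
  refine Finset.sum_congr rfl fun b _ => ?_
  rw [real_inner_smul_left, real_inner_smul_right]
  rw [← mul_assoc, mul_comm]
  rfl

omit [RiemannianBundle (fun x : M => TangentSpace (𝓡 n) x)] in
theorem hasFDerivAt_chartTransition (c c' : M) {y : EuclideanSpace ℝ (Fin n)}
    (hy : y ∈ (extChartAt (𝓡 n) c).target)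
    (hy' : (extChartAt (𝓡 n) c).symm y ∈ (extChartAt (𝓡 n) c').source) :
    HasFDerivAt (extChartAt (𝓡 n) c' ∘ (extChartAt (𝓡 n) c).symm)
      (show EuclideanSpace ℝ (Fin n) →L[ℝ] EuclideanSpace ℝ (Fin n) from
        (mfderiv (𝓡 n) (𝓡 n) (extChartAt (𝓡 n) c') ((extChartAt (𝓡 n) c).symm y)).comp
          (mfderiv (𝓡 n) (𝓡 n) (extChartAt (𝓡 n) c).symm y)) y := by
  have := isManifold_one (n := n) (M := M)
  rw [extChartAt_source] at hy'
  have h1 := (mdifferentiableAt_extChartAt (I := 𝓡 n) hy').hasMFDerivAt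
  have h2 := (mdifferentiableAt_extChartAt_symm c hy).hasMFDerivAt
  exact (HasMFDerivAt.comp y h1 h2).hasFDerivAt

/-- Under a change of charts the volume density is multiplied by the Jacobian of the
transition map. -/
theorem volDensity_eq_abs_det_mul (c c' : M) {y : EuclideanSpace ℝ (Fin n)}
    (hy : y ∈ (extChartAt (𝓡 n) c).target)
    (hy' : (extChartAt (𝓡 n) c).symm y ∈ (extChartAt (𝓡 n) c').source) :
    volDensity c y =
      |(fderiv ℝ (extChartAt (𝓡 n) c' ∘ (extChartAt (𝓡 n) c).symm) y).det| *
        volDensity c' (extChartAt (𝓡 n) c' ((extChartAt (𝓡 n) c).symm y)) := by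
  rw [(hasFDerivAt_chartTransition c c' hy hy').fderiv]
  set J : EuclideanSpace ℝ (Fin n) →L[ℝ] EuclideanSpace ℝ (Fin n) :=
    (mfderiv (𝓡 n) (𝓡 n) (extChartAt (𝓡 n) c') ((extChartAt (𝓡 n) c).symm y)).comp
          (mfderiv (𝓡 n) (𝓡 n) (extChartAt (𝓡 n) c).symm y) with hJ
  let B := (EuclideanSpace.basisFun (Fin n) ℝ).toBasis
  have hB : ∀ i, B i = stdVec n i := fun i => by simp [B, stdVec]
  have hm : metricMatrix c y = (LinearMap.toMatrix B B J.toLinearMap).transpose *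
      metricMatrix c' (extChartAt (𝓡 n) c' ((extChartAt (𝓡 n) c).symm y)) *
      LinearMap.toMatrix B B J.toLinearMap := by
    ext i j
    have hentry : ∀ a i, LinearMap.toMatrix B B J.toLinearMap a i = J (stdVec n i) a := by
      intro a i
      rw [LinearMap.toMatrix_apply, hB]
      simp [B]
    refine (inner_eq_metricMatrix c' hy' (coordVec c y i) (coordVec c y j)).trans ?_
    simp only [Matrix.mul_apply, Matrix.transpose_apply, hentry, Finset.sum_mul]
    rw [Finset.sum_comm]
    refine Finset.sum_congr rfl fun b _ => Finset.sum_congr rfl fun a _ => ?_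
    rw [mul_comm (J (stdVec n i) a), mul_assoc]
    rfl
  have hdet : (LinearMap.toMatrix B B J.toLinearMap).det = J.det := by
    rw [LinearMap.det_toMatrix]
  rw [volDensity, hm, Matrix.det_mul, Matrix.det_mul, Matrix.det_transpose, hdet, volDensity,
    ← Real.sqrt_sq_eq_abs, ← Real.sqrt_mul (sq_nonneg _)]
  ring_nf

variable [MeasurableSpace M] [BorelSpace M]

omit [IsManifold (𝓡 n) ∞ M] [RiemannianBundle (fun x : M => TangentSpace (𝓡 n) x)] in
theorem measurableSet_target_inter_preimage (c : M) {A : Set M} (hA : MeasurableSet A) :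
    MeasurableSet ((extChartAt (𝓡 n) c).target ∩ (extChartAt (𝓡 n) c).symm ⁻¹' A) := by
  have hT : MeasurableSet (extChartAt (𝓡 n) c).target := (isOpen_extChartAt_target c).measurableSet
  have hc : Continuous ((extChartAt (𝓡 n) c).target.domRestrict (extChartAt (𝓡 n) c).symm) :=
    (continuousOn_extChartAt_symm c).domRestrict
  have h := (MeasurableEmbedding.subtype_coe hT).measurableSet_image.2 (hc.measurable hA)
  convert h using 1
  ext y
  simp [and_comm]

omit [IsManifold (𝓡 n) ∞ M] in
theorem aemeasurable_extChartAt_symm (c : M) : AEMeasurable (extChartAt (𝓡 n) c).symm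
    ((volume.restrict (extChartAt (𝓡 n) c).target).withDensity
      fun y => ENNReal.ofReal (volDensity c y)) :=
  ((continuousOn_extChartAt_symm c).aemeasurable
    (isOpen_extChartAt_target c).measurableSet).mono_ac (withDensity_absolutelyContinuous _ _)

omit [IsManifold (𝓡 n) ∞ M] in
theorem chartVolume_apply (c : M) {A : Set M} (hA : MeasurableSet A) :
    chartVolume n c A = ∫⁻ y in (extChartAt (𝓡 n) c).target ∩ (extChartAt (𝓡 n) c).symm ⁻¹' A,
      ENNReal.ofReal (volDensity c y) := by
  have hT : MeasurableSet (extChartAt (𝓡 n) c).target := (isOpen_extChartAt_target c).measurableSet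
  rw [chartVolume, Measure.map_apply_of_aemeasurable (aemeasurable_extChartAt_symm c) hA,
    ← restrict_withDensity hT, Measure.restrict_apply' hT, Set.inter_comm,
    withDensity_apply _ (measurableSet_target_inter_preimage c hA)]

omit [IsManifold (𝓡 n) ∞ M] in
theorem chartVolume_inter_source (c : M) {A : Set M} (hA : MeasurableSet A) :
    chartVolume n c (A ∩ (extChartAt (𝓡 n) c).source) = chartVolume n c A := by
  rw [chartVolume_apply c hA,
    chartVolume_apply c (hA.inter (isOpen_extChartAt_source c).measurableSet)]
  congr 2
  ext y
  simp only [Set.mem_inter_iff, Set.mem_preimage]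
  exact ⟨fun h => ⟨h.1, h.2.1⟩, fun h => ⟨h.1, h.2, (extChartAt (𝓡 n) c).map_target h.1⟩⟩

/-- Two charts give the same volume to sets in the intersection of their domains. -/
theorem chartVolume_eq_of_subset (c c' : M) {A : Set M} (hA : MeasurableSet A)
    (hc : A ⊆ (extChartAt (𝓡 n) c).source) (hc' : A ⊆ (extChartAt (𝓡 n) c').source) :
    chartVolume n c A = chartVolume n c' A := by
  rw [chartVolume_apply c hA, chartVolume_apply c' hA]
  set e := extChartAt (𝓡 n) c with he
  set e' := extChartAt (𝓡 n) c' with he'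
  -- The transition map carries the coordinate image of `A` in one chart to that in the other.
  have himg : (e' ∘ e.symm) '' (e.target ∩ e.symm ⁻¹' A) = e'.target ∩ e'.symm ⁻¹' A := by
    ext z
    constructor
    · rintro ⟨y, ⟨hy, hyA⟩, rfl⟩
      refine ⟨e'.map_source (hc' hyA), ?_⟩
      simpa [e'.left_inv (hc' hyA)] using hyA
    · rintro ⟨hz, hzA⟩
      refine ⟨e (e'.symm z), ⟨e.map_source (hc hzA), ?_⟩, ?_⟩
      · simpa [e.left_inv (hc hzA)] using hzA
      · simp [e.left_inv (hc hzA), e'.right_inv hz]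
  have hinj : Set.InjOn (e' ∘ e.symm) (e.target ∩ e.symm ⁻¹' A) := by
    intro y hy z hz h
    exact e.symm.injOn hy.1 hz.1 (e'.injOn (hc' hy.2) (hc' hz.2) h)
  rw [← himg, lintegral_image_eq_lintegral_abs_det_fderiv_mul volume
    (measurableSet_target_inter_preimage c hA)
    (fun y hy => (hasFDerivAt_chartTransition c c' hy.1 (hc' hy.2)).hasFDerivWithinAt) hinj]
  refine setLIntegral_congr_fun (measurableSet_target_inter_preimage c hA) fun y hy => ?_
  simp only
  rw [volDensity_eq_abs_det_mul c c' hy.1 (hc' hy.2),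
    (hasFDerivAt_chartTransition c c' hy.1 (hc' hy.2)).fderiv,
    ENNReal.ofReal_mul (abs_nonneg _)]
  rfl

/-- The volume of a chart is, as an outer measure, a lower bound for the volume computed in any
chart; so it is a lower bound for the outer measure generated by `localVolume`. -/
theorem chartVolume_le_localVolume (c : M) (A : Set M) :
    chartVolume n c A ≤ localVolume n A := by
  refine le_iInf₂ fun c' hc' => ?_
  have hS : ∀ a : M, MeasurableSet (extChartAt (𝓡 n) a).source :=
    fun a => (isOpen_extChartAt_source a).measurableSet
  -- `A` need not be measurable; it is replaced by a measurable hull inside the domain of `c'`.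
  set B := toMeasurable (chartVolume n c') A ∩ (extChartAt (𝓡 n) c').source with hB
  have hBm : MeasurableSet B := (measurableSet_toMeasurable _ _).inter (hS c')
  calc chartVolume n c A ≤ chartVolume n c B :=
        measure_mono (Set.subset_inter (subset_toMeasurable _ _) hc')
    _ = chartVolume n c (B ∩ (extChartAt (𝓡 n) c).source) :=
        (chartVolume_inter_source c hBm).symm
    _ = chartVolume n c' (B ∩ (extChartAt (𝓡 n) c).source) :=
        chartVolume_eq_of_subset c c' (hBm.inter (hS c)) Set.inter_subset_right
          (Set.inter_subset_left.trans Set.inter_subset_right)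
    _ ≤ chartVolume n c' (toMeasurable (chartVolume n c') A) :=
        measure_mono (Set.inter_subset_left.trans Set.inter_subset_left)
    _ = chartVolume n c' A := measure_toMeasurable _

/-- On the domain of a chart the Riemannian volume is `√(det g_ij) dy`. -/
theorem riemannianVolume_restrict_source (c : M) :
    (riemannianVolume n M).restrict (extChartAt (𝓡 n) c).source = chartVolume n c := by
  have hS : MeasurableSet (extChartAt (𝓡 n) c).source := (isOpen_extChartAt_source c).measurableSet
  ext A hA
  rw [Measure.restrict_apply hA, ← chartVolume_inter_source c hA, riemannianVolume,
    toMeasure_apply _ _ (hA.inter hS)]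
  refine le_antisymm ?_ ?_
  · exact (OuterMeasure.boundedBy_le _).trans (iInf₂_le c Set.inter_subset_right)
  · have h : (chartVolume n c).toOuterMeasure ≤ volumeOuter n M :=
      OuterMeasure.le_boundedBy.2 fun s => chartVolume_le_localVolume c s
    exact h _

variable [IsContMDiffRiemannianBundle (𝓡 n) ∞ (EuclideanSpace ℝ (Fin n))
  (fun x : M => TangentSpace (𝓡 n) x)]

theorem integral_chartVolume (c : M) {h : M → ℝ}
    (hh : AEStronglyMeasurable h (chartVolume n c)) :
    ∫ x, h x ∂(chartVolume n c) = ∫ y in (extChartAt (𝓡 n) c).target,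
      volDensity c y * h ((extChartAt (𝓡 n) c).symm y) := by
  have hd : AEMeasurable (fun y => ENNReal.ofReal (volDensity c y))
      (volume.restrict (extChartAt (𝓡 n) c).target) :=
    ((contDiffOn_volDensity c).continuousOn.aemeasurable
      (isOpen_extChartAt_target c).measurableSet).ennreal_ofReal
  rw [chartVolume, integral_map (aemeasurable_extChartAt_symm c) hh,
    integral_withDensity_eq_integral_toReal_smul₀ hd (.of_forall fun _ => ENNReal.ofReal_lt_top)]
  refine integral_congr_ae (.of_forall fun y => ?_)
  simp only [volDensity, smul_eq_mul, ENNReal.toReal_ofReal (Real.sqrt_nonneg _)]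

end Volume

/-! ### The divergence theorem in a chart -/

section DivergenceTheorem

variable {n : ℕ} {M : Type*} [TopologicalSpace M] [ChartedSpace (EuclideanSpace ℝ (Fin n)) M]
  [IsManifold (𝓡 n) ∞ M]

omit [IsManifold (𝓡 n) ∞ M] in
theorem extChartAt_target_inter_preimage_open (c : M) {U : Set M} (hU : IsOpen U) :
    IsOpen ((extChartAt (𝓡 n) c).target ∩ (extChartAt (𝓡 n) c).symm ⁻¹' U) :=
  (continuousOn_extChartAt_symm c).isOpen_inter_preimage (isOpen_extChartAt_target c) hU

omit [IsManifold (𝓡 n) ∞ M] in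
theorem continuousOn_of_comp_symm (c : M) {h : M → ℝ}
    (hh : ContinuousOn (h ∘ (extChartAt (𝓡 n) c).symm) (extChartAt (𝓡 n) c).target) :
    ContinuousOn h (extChartAt (𝓡 n) c).source := by
  refine (hh.comp (continuousOn_extChartAt c) fun x hx => (extChartAt (𝓡 n) c).map_source hx).congr
    fun x hx => ?_
  simp only [Function.comp_apply, (extChartAt (𝓡 n) c).left_inv hx]

/-- The coordinate expression, extended by zero, of a smooth function with compact support in the
domain of a chart is smooth. -/
theorem contDiff_indicator_comp_symm (c : M) {φ : M → ℝ} (hφ : ContMDiff (𝓡 n) 𝓘(ℝ, ℝ) ∞ φ)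
    (hc : HasCompactSupport φ) (hs : tsupport φ ⊆ (extChartAt (𝓡 n) c).source) :
    ContDiff ℝ ∞ ((extChartAt (𝓡 n) c).target.indicator (φ ∘ (extChartAt (𝓡 n) c).symm)) ∧
    HasCompactSupport ((extChartAt (𝓡 n) c).target.indicator (φ ∘ (extChartAt (𝓡 n) c).symm)) ∧
    tsupport ((extChartAt (𝓡 n) c).target.indicator (φ ∘ (extChartAt (𝓡 n) c).symm)) ⊆
      (extChartAt (𝓡 n) c).target := by
  set e := extChartAt (𝓡 n) c with he
  have hT : IsOpen e.target := isOpen_extChartAt_target c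
  have hK : IsCompact (e '' tsupport φ) := hc.image_of_continuousOn
    ((continuousOn_extChartAt c).mono hs)
  have hKT : e '' tsupport φ ⊆ e.target := by
    rintro _ ⟨x, hx, rfl⟩
    exact e.map_source (hs hx)
  have h0 : ∀ y ∉ e '' tsupport φ, e.target.indicator (φ ∘ e.symm) y = 0 := by
    intro y hy
    by_cases hyT : y ∈ e.target
    · rw [Set.indicator_of_mem hyT]
      by_contra hne
      exact hy ⟨e.symm y, subset_tsupport _ hne, e.right_inv hyT⟩
    · exact Set.indicator_of_notMem hyT _
  refine ⟨contDiff_iff_contDiffAt.2 fun y => ?_, HasCompactSupport.intro hK h0, ?_⟩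
  · by_cases hyT : y ∈ e.target
    · have h1 : ContDiffAt ℝ ∞ (φ ∘ e.symm) y :=
        (contMDiffOn_iff_contDiffOn.1 (hφ.comp_contMDiffOn
          (contMDiffOn_extChartAt_symm (n := ∞) c))).contDiffAt (hT.mem_nhds hyT)
      refine h1.congr_of_eventuallyEq ?_
      filter_upwards [hT.mem_nhds hyT] with z hz
      exact Set.indicator_of_mem hz _
    · have h2 : (e '' tsupport φ)ᶜ ∈ nhds y :=
        hK.isClosed.isOpen_compl.mem_nhds fun h => hyT (hKT h)
      refine (contDiffAt_const (c := (0 : ℝ))).congr_of_eventuallyEq ?_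
      filter_upwards [h2] with z hz
      exact h0 z hz
  · refine (closure_minimal (fun y hy => ?_) hK.isClosed).trans hKT
    by_contra hne
    exact hy (h0 y hne)

variable [RiemannianBundle (fun x : M => TangentSpace (𝓡 n) x)]

/-- A vector field all of whose components in charts are smooth. -/
def HasSmoothComponents (X : ∀ x : M, TangentSpace (𝓡 n) x) : Prop :=
  ∀ (c : M) (i : Fin n), ContDiffOn ℝ ∞ (chartComponent c X i) (extChartAt (𝓡 n) c).target

variable [IsContMDiffRiemannianBundle (𝓡 n) ∞ (EuclideanSpace ℝ (Fin n))
  (fun x : M => TangentSpace (𝓡 n) x)]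

theorem contDiffOn_volDensity_mul_chartComponent {X : ∀ x : M, TangentSpace (𝓡 n) x}
    (hX : HasSmoothComponents X) (c : M) (i : Fin n) :
    ContDiffOn ℝ ∞ (fun z => volDensity c z * chartComponent c X i z)
      (extChartAt (𝓡 n) c).target :=
  (contDiffOn_volDensity c).mul (hX c i)

theorem continuousOn_fderiv_volDensity_mul {X : ∀ x : M, TangentSpace (𝓡 n) x}
    (hX : HasSmoothComponents X) (c : M) (i : Fin n) :
    ContinuousOn (fun y => fderiv ℝ (fun z => volDensity c z * chartComponent c X i z) y
      (stdVec n i)) (extChartAt (𝓡 n) c).target :=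
  ((contDiffOn_volDensity_mul_chartComponent hX c i).continuousOn_fderiv_of_isOpen
    (isOpen_extChartAt_target c) (by simp)).clm_apply continuousOn_const

theorem continuousOn_chartDivergence {X : ∀ x : M, TangentSpace (𝓡 n) x}
    (hX : HasSmoothComponents X) (c : M) :
    ContinuousOn (chartDivergence c X) (extChartAt (𝓡 n) c).target :=
  ((contDiffOn_volDensity c).continuousOn.inv₀ fun _ hy => (volDensity_pos c hy).ne').mul
    (continuousOn_finsetSum _ fun i _ => continuousOn_fderiv_volDensity_mul hX c i)

theorem continuousOn_chartDivergence_comp {X : ∀ x : M, TangentSpace (𝓡 n) x}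
    (hX : HasSmoothComponents X) (c : M) :
    ContinuousOn (fun x => chartDivergence c X (extChartAt (𝓡 n) c x))
      (extChartAt (𝓡 n) c).source :=
  (continuousOn_chartDivergence hX c).comp (continuousOn_extChartAt c)
    fun _ hx => (extChartAt (𝓡 n) c).map_source hx

omit [IsContMDiffRiemannianBundle (𝓡 n) ∞ (EuclideanSpace ℝ (Fin n))
  (fun x : M => TangentSpace (𝓡 n) x)]
  [RiemannianBundle (fun x : M => TangentSpace (𝓡 n) x)] in
theorem continuousOn_mvfderiv_apply_comp_symm {X : ∀ x : M, TangentSpace (𝓡 n) x}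
    (hX : HasSmoothComponents X) {φ : M → ℝ} (hφ : ContMDiff (𝓡 n) 𝓘(ℝ, ℝ) ∞ φ) (c : M) :
    ContinuousOn ((fun x => mvfderiv (𝓡 n) φ x (X x)) ∘ (extChartAt (𝓡 n) c).symm)
      (extChartAt (𝓡 n) c).target := by
  have h1 : ContDiffOn ℝ ∞ (φ ∘ (extChartAt (𝓡 n) c).symm) (extChartAt (𝓡 n) c).target :=
    contMDiffOn_iff_contDiffOn.1 (hφ.comp_contMDiffOn (contMDiffOn_extChartAt_symm (n := ∞) c))
  have h2 : ContinuousOn (fun y => ∑ i, chartComponent c X i y *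
      fderiv ℝ (φ ∘ (extChartAt (𝓡 n) c).symm) y (stdVec n i)) (extChartAt (𝓡 n) c).target :=
    continuousOn_finsetSum _ fun i _ => (hX c i).continuousOn.mul
      ((h1.continuousOn_fderiv_of_isOpen (isOpen_extChartAt_target c) (by simp)).clm_apply
        continuousOn_const)
  exact h2.congr fun y hy => mvfderiv_apply_eq_sum c X hy ((hφ _).mdifferentiableAt (by simp))

omit [IsContMDiffRiemannianBundle (𝓡 n) ∞ (EuclideanSpace ℝ (Fin n))
  (fun x : M => TangentSpace (𝓡 n) x)]
  [RiemannianBundle (fun x : M => TangentSpace (𝓡 n) x)] in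
theorem continuous_mvfderiv_apply {X : ∀ x : M, TangentSpace (𝓡 n) x}
    (hX : HasSmoothComponents X) {φ : M → ℝ} (hφ : ContMDiff (𝓡 n) 𝓘(ℝ, ℝ) ∞ φ) :
    Continuous fun x => mvfderiv (𝓡 n) φ x (X x) :=
  continuous_iff_continuousAt.2 fun x =>
    (continuousOn_of_comp_symm x (continuousOn_mvfderiv_apply_comp_symm hX hφ x)).continuousAt
      ((isOpen_extChartAt_source x).mem_nhds (mem_extChartAt_source x))

omit [IsContMDiffRiemannianBundle (𝓡 n) ∞ (EuclideanSpace ℝ (Fin n))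
  (fun x : M => TangentSpace (𝓡 n) x)]
  [RiemannianBundle (fun x : M => TangentSpace (𝓡 n) x)] [IsManifold (𝓡 n) ∞ M] in
theorem mvfderiv_eq_zero_of_notMem_tsupport {φ : M → ℝ} {x : M} (hx : x ∉ tsupport φ) :
    mvfderiv (𝓡 n) φ x = 0 := by
  have h : φ =ᶠ[nhds x] fun _ => 0 := notMem_tsupport_iff_eventuallyEq.1 hx
  have h2 : mvfderiv (𝓡 n) φ x = mvfderiv (𝓡 n) (fun _ : M => (0 : ℝ)) x :=
    h.mfderiv_eq
  rw [h2, mvfderiv_const]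

variable [MeasurableSpace M] [BorelSpace M]

instance isLocallyFiniteMeasure_riemannianVolume :
    IsLocallyFiniteMeasure (riemannianVolume n M) := by
  refine ⟨fun x => ?_⟩
  set e := extChartAt (𝓡 n) x with he
  have hT : IsOpen e.target := isOpen_extChartAt_target x
  obtain ⟨K, hK, hxK, hKT⟩ := exists_compact_subset hT (mem_extChartAt_target (I := 𝓡 n) x)
  have hN : IsOpen (e.source ∩ e ⁻¹' interior K) :=
    (continuousOn_extChartAt x).isOpen_inter_preimage (isOpen_extChartAt_source x) isOpen_interior
  refine ⟨_, hN.mem_nhds ⟨mem_extChartAt_source x, hxK⟩, ?_⟩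
  have h1 : riemannianVolume n M (e.source ∩ e ⁻¹' interior K) =
      chartVolume n x (e.source ∩ e ⁻¹' interior K) := by
    rw [← riemannianVolume_restrict_source x, Measure.restrict_apply hN.measurableSet]
    congr 1
    ext z
    simp only [Set.mem_inter_iff]
    tauto
  rw [h1, chartVolume_apply x hN.measurableSet]
  refine (lintegral_mono_set (t := K) ?_).trans_lt ?_
  · rintro y ⟨hy, -, hy2⟩
    rw [Set.mem_preimage, e.right_inv hy] at hy2
    exact interior_subset hy2
  · exact (((contDiffOn_volDensity x).continuousOn.mono hKT).integrableOn_compact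
      hK).lintegral_lt_top

instance isOpenPosMeasure_riemannianVolume : (riemannianVolume n M).IsOpenPosMeasure := by
  refine ⟨fun U hU ⟨x, hx⟩ h0 => ?_⟩
  have hV := extChartAt_target_inter_preimage_open (n := n) x hU
  have h1 : chartVolume n x U = 0 := by
    rw [← riemannianVolume_restrict_source x]
    exact le_antisymm ((Measure.restrict_apply_le _ _).trans h0.le) bot_le
  rw [chartVolume_apply x hU.measurableSet, lintegral_eq_zero_iff'
    (((contDiffOn_volDensity x).continuousOn.mono Set.inter_subset_left).aemeasurable
      hV.measurableSet).ennreal_ofReal] at h1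
  have h2 : ∀ᵐ y, y ∉ (extChartAt (𝓡 n) x).target ∩ (extChartAt (𝓡 n) x).symm ⁻¹' U := by
    filter_upwards [(ae_restrict_iff' hV.measurableSet).1 h1] with y hy hyV
    have := hy hyV
    simp only [Pi.zero_apply, ENNReal.ofReal_eq_zero] at this
    exact this.not_gt (volDensity_pos x hyV.1)
  have h3 := measure_eq_zero_iff_ae_notMem.2 h2
  refine (hV.measure_pos volume ⟨extChartAt (𝓡 n) x x, mem_extChartAt_target x, ?_⟩).ne' h3
  simpa using hx

/-- The integral of a function that vanishes off the domain of a chart, in coordinates. -/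
theorem integral_eq_integral_target (c : M) {h : M → ℝ}
    (h0 : ∀ x ∉ (extChartAt (𝓡 n) c).source, h x = 0)
    (hh : ContinuousOn (h ∘ (extChartAt (𝓡 n) c).symm) (extChartAt (𝓡 n) c).target) :
    ∫ x, h x ∂(riemannianVolume n M) = ∫ y in (extChartAt (𝓡 n) c).target,
      volDensity c y * h ((extChartAt (𝓡 n) c).symm y) := by
  rw [← setIntegral_eq_integral_of_forall_compl_eq_zero h0, riemannianVolume_restrict_source,
    integral_chartVolume]
  rw [← riemannianVolume_restrict_source]
  exact (continuousOn_of_comp_symm c hh).aestronglyMeasurable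
    (isOpen_extChartAt_source c).measurableSet

/-- The divergence theorem in one chart, against a test function supported there. -/
theorem integral_mul_chartDivergence {X : ∀ x : M, TangentSpace (𝓡 n) x}
    (hX : HasSmoothComponents X) (c : M) {φ : M → ℝ} (hφ : ContMDiff (𝓡 n) 𝓘(ℝ, ℝ) ∞ φ)
    (hc : HasCompactSupport φ) (hs : tsupport φ ⊆ (extChartAt (𝓡 n) c).source) :
    ∫ x, φ x * chartDivergence c X (extChartAt (𝓡 n) c x) ∂(riemannianVolume n M) =
      -∫ x, mvfderiv (𝓡 n) φ x (X x) ∂(riemannianVolume n M) := by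
  have hT : IsOpen (extChartAt (𝓡 n) c).target := isOpen_extChartAt_target c
  have hpt : ∀ y ∈ (extChartAt (𝓡 n) c).target,
      extChartAt (𝓡 n) c ((extChartAt (𝓡 n) c).symm y) = y :=
    fun y hy => (extChartAt (𝓡 n) c).right_inv hy
  have hφs : ContinuousOn (φ ∘ (extChartAt (𝓡 n) c).symm) (extChartAt (𝓡 n) c).target :=
    hφ.continuous.comp_continuousOn (continuousOn_extChartAt_symm c)
  obtain ⟨hu, huc, hus⟩ := contDiff_indicator_comp_symm c hφ hc hs
  set u := (extChartAt (𝓡 n) c).target.indicator (φ ∘ (extChartAt (𝓡 n) c).symm) with hudef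
  rw [integral_eq_integral_target c, integral_eq_integral_target c]
  rotate_left
  · intro x hx
    rw [mvfderiv_eq_zero_of_notMem_tsupport fun h => hx (hs h)]
    rfl
  · exact continuousOn_mvfderiv_apply_comp_symm hX hφ c
  · intro x hx
    rw [image_eq_zero_of_notMem_tsupport fun h => hx (hs h), zero_mul]
  · exact (hφs.mul (continuousOn_chartDivergence hX c)).congr fun y hy => by
      simp only [Function.comp_apply, hpt y hy, Pi.mul_apply]
  have hu1 : ∀ i, Continuous fun y => fderiv ℝ u y (stdVec n i) := fun i =>
    (hu.continuous_fderiv (by simp)).clm_apply continuous_const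
  have hL : ∀ i, Integrable (fun y => u y *
      fderiv ℝ (fun z => volDensity c z * chartComponent c X i z) y (stdVec n i)) := fun i =>
    integrable_mul_of_tsupport_subset hu.continuous huc hus
      (continuousOn_fderiv_volDensity_mul hX c i)
  have htd : ∀ i, tsupport (fun y => fderiv ℝ u y (stdVec n i)) ⊆ tsupport u := fun i =>
    tsupport_fderiv_apply_subset ℝ (stdVec n i)
  have hR : ∀ i, Integrable (fun y => fderiv ℝ u y (stdVec n i) *
      (volDensity c y * chartComponent c X i y)) := fun i =>
    integrable_mul_of_tsupport_subset (hu1 i) (huc.fderiv_apply ℝ (stdVec n i))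
      ((htd i).trans hus) (contDiffOn_volDensity_mul_chartComponent hX c i).continuousOn
  have hLeq : ∫ y in (extChartAt (𝓡 n) c).target, volDensity c y *
      (φ ((extChartAt (𝓡 n) c).symm y) * chartDivergence c X
        (extChartAt (𝓡 n) c ((extChartAt (𝓡 n) c).symm y))) =
      ∑ i, ∫ y, u y *
        fderiv ℝ (fun z => volDensity c z * chartComponent c X i z) y (stdVec n i) := by
    rw [← integral_finsetSum _ fun i _ => hL i]
    refine Eq.trans ?_ (setIntegral_eq_integral_of_forall_compl_eq_zero
      (s := (extChartAt (𝓡 n) c).target) ?_)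
    · refine setIntegral_congr_fun hT.measurableSet fun y hy => ?_
      simp only [hudef, Set.indicator_of_mem hy, hpt y hy, chartDivergence, ← Finset.mul_sum,
        Function.comp_apply]
      have := (volDensity_pos c hy).ne'
      field_simp
    · intro y hy
      simp only [hudef, Set.indicator_of_notMem hy, zero_mul, Finset.sum_const_zero]
  have hReq : ∫ y in (extChartAt (𝓡 n) c).target, volDensity c y *
      mvfderiv (𝓡 n) φ ((extChartAt (𝓡 n) c).symm y) (X ((extChartAt (𝓡 n) c).symm y)) =
      ∑ i, ∫ y, fderiv ℝ u y (stdVec n i) * (volDensity c y * chartComponent c X i y) := by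
    rw [← integral_finsetSum _ fun i _ => hR i]
    refine Eq.trans ?_ (setIntegral_eq_integral_of_forall_compl_eq_zero
      (s := (extChartAt (𝓡 n) c).target) ?_)
    · refine setIntegral_congr_fun hT.measurableSet fun y hy => ?_
      have hd : fderiv ℝ u y = fderiv ℝ (φ ∘ (extChartAt (𝓡 n) c).symm) y := by
        refine Filter.EventuallyEq.fderiv_eq ?_
        filter_upwards [hT.mem_nhds hy] with z hz
        exact Set.indicator_of_mem hz _
      simp only [hd]
      rw [mvfderiv_apply_eq_sum c X hy ((hφ _).mdifferentiableAt (by simp)), Finset.mul_sum]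
      exact Finset.sum_congr rfl fun i _ => by ring
    · intro y hy
      refine Finset.sum_eq_zero fun i _ => ?_
      rw [image_eq_zero_of_notMem_tsupport (f := fun y => fderiv ℝ u y (stdVec n i))
        fun h => hy (hus (htd i h)), zero_mul]
  rw [hLeq, hReq, ← Finset.sum_neg_distrib]
  refine Finset.sum_congr rfl fun i _ => ?_
  refine integral_mul_fderiv_eq_neg_fderiv_mul_of_integrable (hR i) (hL i) ?_ ?_ ?_
  · exact integrable_mul_of_tsupport_subset hu.continuous huc hus
      (contDiffOn_volDensity_mul_chartComponent hX c i).continuousOn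
  · exact fun y _ => (hu.differentiable (by simp)).differentiableAt
  · exact fun y hy => ((contDiffOn_volDensity_mul_chartComponent hX c i).differentiableOn
      (by simp)).differentiableAt (hT.mem_nhds (hus hy))

end DivergenceTheorem

/-! ### Chart independence of the divergence, and the global divergence theorem -/

section GlobalDivergence

variable {n : ℕ} {M : Type*} [TopologicalSpace M] [ChartedSpace (EuclideanSpace ℝ (Fin n)) M]
  [IsManifold (𝓡 n) ∞ M] [RiemannianBundle (fun x : M => TangentSpace (𝓡 n) x)]
  [IsContMDiffRiemannianBundle (𝓡 n) ∞ (EuclideanSpace ℝ (Fin n))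
    (fun x : M => TangentSpace (𝓡 n) x)]
  [T2Space M] [SecondCountableTopology M]

/-- The coordinate expression of the divergence does not depend on the chart. On the overlap of two
charts both expressions are continuous and, by the divergence theorem in each chart, have the same
integral against every test function. -/
theorem chartDivergence_eq {X : ∀ x : M, TangentSpace (𝓡 n) x}
    (hX : HasSmoothComponents X) (c c' : M) {x : M}
    (hx : x ∈ (extChartAt (𝓡 n) c).source) (hx' : x ∈ (extChartAt (𝓡 n) c').source) :
    chartDivergence c X (extChartAt (𝓡 n) c x) =
      chartDivergence c' X (extChartAt (𝓡 n) c' x) := by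
  have := ChartedSpace.locallyCompactSpace (EuclideanSpace ℝ (Fin n)) M
  let _ : MeasurableSpace M := borel M
  have : BorelSpace M := ⟨rfl⟩
  set U := (extChartAt (𝓡 n) c).source ∩ (extChartAt (𝓡 n) c').source with hUdef
  have hU : IsOpen U := (isOpen_extChartAt_source c).inter (isOpen_extChartAt_source c')
  have h1 : ContinuousOn (fun x => chartDivergence c X (extChartAt (𝓡 n) c x)) U :=
    (continuousOn_chartDivergence_comp hX c).mono Set.inter_subset_left
  have h2 : ContinuousOn (fun x => chartDivergence c' X (extChartAt (𝓡 n) c' x)) U :=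
    (continuousOn_chartDivergence_comp hX c').mono Set.inter_subset_right
  have hae := hU.ae_eq_zero_of_integral_contMDiff_smul_eq_zero (𝓡 n)
    (μ := riemannianVolume n M)
    ((h1.sub h2).locallyIntegrableOn hU.measurableSet) fun φ hφ hc hs => by
      have e1 := integral_mul_chartDivergence hX c hφ hc (hs.trans Set.inter_subset_left)
      have e2 := integral_mul_chartDivergence hX c' hφ hc (hs.trans Set.inter_subset_right)
      simp only [smul_eq_mul, Pi.sub_apply, mul_sub]
      rw [integral_sub, e1, e2, sub_self]
      · exact integrable_mul_of_tsupport_subset hφ.continuous hc hs h1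
      · exact integrable_mul_of_tsupport_subset hφ.continuous hc hs h2
  have hae' : (fun x => chartDivergence c X (extChartAt (𝓡 n) c x))
      =ᵐ[(riemannianVolume n M).restrict U]
        fun x => chartDivergence c' X (extChartAt (𝓡 n) c' x) := by
    refine (ae_restrict_iff' hU.measurableSet).2 ?_
    filter_upwards [hae] with z hz hzU
    exact sub_eq_zero.1 (hz hzU)
  exact Measure.eqOn_open_of_ae_eq hae' hU h1 h2 ⟨hx, hx'⟩

theorem divergence_eq_chartDivergence {X : ∀ x : M, TangentSpace (𝓡 n) x}
    (hX : HasSmoothComponents X) (c : M) {x : M} (hx : x ∈ (extChartAt (𝓡 n) c).source) :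
    divergence X x = chartDivergence c X (extChartAt (𝓡 n) c x) :=
  chartDivergence_eq hX x c (mem_extChartAt_source x) hx

theorem continuous_divergence {X : ∀ x : M, TangentSpace (𝓡 n) x}
    (hX : HasSmoothComponents X) : Continuous (divergence X) := by
  refine continuous_iff_continuousAt.2 fun x => ?_
  have hn := (isOpen_extChartAt_source (I := 𝓡 n) x).mem_nhds (mem_extChartAt_source x)
  refine ((continuousOn_chartDivergence_comp hX x).continuousAt hn).congr ?_
  filter_upwards [hn] with z hz
  exact (divergence_eq_chartDivergence hX x hz).symm

variable [MeasurableSpace M] [BorelSpace M]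

theorem integrable_mul_divergence {X : ∀ x : M, TangentSpace (𝓡 n) x}
    (hX : HasSmoothComponents X) {φ : M → ℝ} (hφ : ContMDiff (𝓡 n) 𝓘(ℝ, ℝ) ∞ φ)
    (hc : HasCompactSupport φ) :
    Integrable (fun x => φ x * divergence X x) (riemannianVolume n M) :=
  integrable_mul_of_tsupport_subset hφ.continuous hc (Set.subset_univ _)
    (continuous_divergence hX).continuousOn

omit [SecondCountableTopology M] in
theorem integrable_mvfderiv_apply {X : ∀ x : M, TangentSpace (𝓡 n) x}
    (hX : HasSmoothComponents X) {φ : M → ℝ} (hφ : ContMDiff (𝓡 n) 𝓘(ℝ, ℝ) ∞ φ)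
    (hc : HasCompactSupport φ) :
    Integrable (fun x => mvfderiv (𝓡 n) φ x (X x)) (riemannianVolume n M) := by
  refine (continuous_mvfderiv_apply hX hφ).integrable_of_hasCompactSupport
    (HasCompactSupport.intro hc fun x hx => ?_)
  rw [mvfderiv_eq_zero_of_notMem_tsupport hx]
  rfl

/-- The divergence theorem against a compactly supported test function:
`∫ φ div X dv = -∫ dφ(X) dv`. -/
theorem integral_mul_divergence {X : ∀ x : M, TangentSpace (𝓡 n) x}
    (hX : HasSmoothComponents X) {φ : M → ℝ} (hφ : ContMDiff (𝓡 n) 𝓘(ℝ, ℝ) ∞ φ)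
    (hc : HasCompactSupport φ) :
    ∫ x, φ x * divergence X x ∂(riemannianVolume n M) =
      -∫ x, mvfderiv (𝓡 n) φ x (X x) ∂(riemannianVolume n M) := by
  have := ChartedSpace.locallyCompactSpace (EuclideanSpace ℝ (Fin n)) M
  obtain ⟨ρ, hρ⟩ := SmoothPartitionOfUnity.exists_isSubordinate (𝓡 n) (isClosed_univ (X := M))
    (fun c : M => (extChartAt (𝓡 n) c).source) (fun c => isOpen_extChartAt_source c)
    (fun x _ => Set.mem_iUnion.2 ⟨x, mem_extChartAt_source x⟩)
  have hfin := ρ.locallyFinite.finite_nonempty_inter_compact hc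
  -- Only the finitely many `ρ c` with `c ∈ F` are nonzero somewhere on the support of `φ`.
  set F := hfin.toFinset with hF
  have hρφ : ∀ c, ContMDiff (𝓡 n) 𝓘(ℝ, ℝ) ∞ fun x => ρ c x * φ x :=
    fun c => (ρ c).contMDiff.mul hφ
  have hρc : ∀ c, HasCompactSupport fun x => ρ c x * φ x := fun c => hc.mul_left
  have hone : ∀ c, ∫ x, (ρ c x * φ x) * divergence X x ∂(riemannianVolume n M) =
      -∫ x, mvfderiv (𝓡 n) (fun x => ρ c x * φ x) x (X x) ∂(riemannianVolume n M) := by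
    intro c
    have hs : tsupport (fun x => ρ c x * φ x) ⊆ (extChartAt (𝓡 n) c).source :=
      (tsupport_mul_subset_left (f := ρ c) (g := φ)).trans (hρ c)
    rw [← integral_mul_chartDivergence hX c (hρφ c) (hρc c) hs]
    refine integral_congr_ae (.of_forall fun x => ?_)
    simp only
    by_cases hx : x ∈ (extChartAt (𝓡 n) c).source
    · rw [divergence_eq_chartDivergence hX c hx]
    · rw [image_eq_zero_of_notMem_tsupport (f := fun x => ρ c x * φ x) fun h => hx (hs h),
        zero_mul, zero_mul]
  have hsum : ∀ G : Finset M, ContMDiff (𝓡 n) 𝓘(ℝ, ℝ) ∞ (fun x => ∑ c ∈ G, ρ c x * φ x) ∧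
      ∀ x, mvfderiv (𝓡 n) (fun x => ∑ c ∈ G, ρ c x * φ x) x (X x) =
        ∑ c ∈ G, mvfderiv (𝓡 n) (fun x => ρ c x * φ x) x (X x) := by
    classical
    intro G
    induction G using Finset.induction_on with
    | empty =>
      refine ⟨by simpa using contMDiff_const, fun x => ?_⟩
      simp [mvfderiv_const]
    | insert c G hcG ih =>
      simp only [Finset.sum_insert hcG]
      refine ⟨(hρφ c).add ih.1, fun x => ?_⟩
      rw [mvfderiv_fun_add ((hρφ c x).mdifferentiableAt (by simp))
        ((ih.1 x).mdifferentiableAt (by simp)), add_apply, ih.2]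
  have hφF : ∀ x, φ x = ∑ c ∈ F, ρ c x * φ x := by
    intro x
    by_cases hx : x ∈ tsupport φ
    · rw [← Finset.sum_mul]
      have h1 := ρ.sum_eq_one (Set.mem_univ x)
      rw [finsum_eq_sum_of_support_subset (s := F)] at h1
      · rw [h1, one_mul]
      · intro c hcx
        simp only [hF, Set.Finite.coe_toFinset]
        exact ⟨x, hcx, hx⟩
    · simp [image_eq_zero_of_notMem_tsupport hx]
  have hφF' : φ = fun x => ∑ c ∈ F, ρ c x * φ x := funext hφF
  calc ∫ x, φ x * divergence X x ∂(riemannianVolume n M)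
      = ∫ x, ∑ c ∈ F, (ρ c x * φ x) * divergence X x ∂(riemannianVolume n M) := by
        refine integral_congr_ae (.of_forall fun x => ?_)
        simp only
        rw [← Finset.sum_mul, ← hφF x]
    _ = ∑ c ∈ F, -∫ x, mvfderiv (𝓡 n) (fun x => ρ c x * φ x) x (X x)
          ∂(riemannianVolume n M) := by
        rw [integral_finsetSum _ fun c _ => integrable_mul_divergence hX (hρφ c) (hρc c)]
        exact Finset.sum_congr rfl fun c _ => hone c
    _ = -∫ x, mvfderiv (𝓡 n) φ x (X x) ∂(riemannianVolume n M) := by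
        rw [Finset.sum_neg_distrib, ← integral_finsetSum _ fun c _ =>
          integrable_mvfderiv_apply hX (hρφ c) (hρc c)]
        congr 1
        refine integral_congr_ae (.of_forall fun x => ?_)
        simp only
        rw [← (hsum F).2 x, ← hφF']

end GlobalDivergence

/-! ### Monotonicity of the weighted volume -/

section WeightedMonotonicity

theorem hasDerivAt_rpow_neg_mul_exp (k s : ℝ) {t : ℝ} (ht : 0 < t) :
    HasDerivAt (fun t => t ^ (-k) * Real.exp (-s / t))
      (t ^ (-k) * t⁻¹ * ((s / t - k) * Real.exp (-s / t))) t := by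
  have h1 := Real.hasDerivAt_rpow_const (x := t) (p := -k) (Or.inl ht.ne')
  have h2 : HasDerivAt (fun t => -s / t) (s / t ^ 2) t := by
    have := (hasDerivAt_inv ht.ne').const_mul (-s)
    simp only [← div_eq_mul_inv] at this
    refine this.congr_deriv ?_
    ring
  refine (h1.mul h2.exp).congr_deriv ?_
  rw [Real.rpow_sub_one ht.ne']
  field_simp
  ring

theorem continuousOn_deriv_weight (k a b : ℝ) (ha : 0 < a) :
    ContinuousOn (fun p : ℝ × ℝ => p.1 ^ (-k) * p.1⁻¹ *
      ((p.2 / p.1 - k) * Real.exp (-p.2 / p.1))) (Set.Icc a b ×ˢ Set.univ) := by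
  have h0 : ∀ p ∈ Set.Icc a b ×ˢ (Set.univ : Set ℝ), p.1 ≠ 0 :=
    fun p hp => (ha.trans_le hp.1.1).ne'
  refine ContinuousOn.mul (ContinuousOn.mul ?_ ?_) (ContinuousOn.mul ?_ ?_)
  · exact continuousOn_fst.rpow_const fun p hp => Or.inl (h0 p hp)
  · exact continuousOn_fst.inv₀ h0
  · exact (continuousOn_snd.div continuousOn_fst h0).sub continuousOn_const
  · exact (continuousOn_snd.neg.div continuousOn_fst h0).rexp

/-- A smooth nonincreasing cutoff function, equal to `1` up to `A` and to `0` from `A + 1` on. -/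
noncomputable def cutoff (A s : ℝ) : ℝ := Real.smoothTransition (A + 1 - s)

theorem contDiff_cutoff (A : ℝ) : ContDiff ℝ ∞ (cutoff A) :=
  Real.smoothTransition.contDiff.comp (contDiff_const.sub contDiff_id)

theorem cutoff_nonneg (A s : ℝ) : 0 ≤ cutoff A s := Real.smoothTransition.nonneg _

theorem cutoff_le_one (A s : ℝ) : cutoff A s ≤ 1 := Real.smoothTransition.le_one _

theorem cutoff_eq_one {A s : ℝ} (h : s ≤ A) : cutoff A s = 1 :=
  Real.smoothTransition.one_of_one_le (by linarith)

theorem cutoff_eq_zero {A s : ℝ} (h : A + 1 ≤ s) : cutoff A s = 0 :=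
  Real.smoothTransition.zero_of_nonpos (by linarith)

theorem deriv_cutoff_nonpos (A s : ℝ) : deriv (cutoff A) s ≤ 0 :=
  Antitone.deriv_nonpos fun _ _ h => Real.smoothTransition.monotone (by linarith)

variable {X : Type*} [TopologicalSpace X] [MeasurableSpace X] [BorelSpace X] [T2Space X]
  {μ : Measure X} [IsFiniteMeasureOnCompacts μ] {f L g : X → ℝ} {k : ℝ}

theorem integrable_comp_mul (hf : Continuous f) (hK : ∀ A, IsCompact {x | f x ≤ A}) {u : ℝ → ℝ}
    (hu : Continuous u) {A : ℝ} (huA : ∀ s, A ≤ s → u s = 0) {w : X → ℝ} (hw : Continuous w) :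
    Integrable (fun x => u (f x) * w x) μ := by
  refine ((hu.comp hf).mul hw).integrable_of_hasCompactSupport
    (HasCompactSupport.intro (hK A) fun x hx => ?_)
  have : A ≤ f x := (not_le.1 hx).le
  simp [huA _ this]

/-- The sign of the time derivative of the weighted volume. The test function is
`ψ(f)` with `ψ(s) = η(s) e^{-s/t}`, where `η` is the cutoff. -/
theorem integral_cutoff_mul_nonpos (hf : Continuous f) (hLc : Continuous L) (hgc : Continuous g)
    (hK : ∀ A, IsCompact {x | f x ≤ A}) (hg0 : ∀ x, 0 ≤ g x) (hgf : ∀ x, g x ≤ f x)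
    (hL : ∀ x, L x - g x + f x ≤ k)
    (hibp : ∀ ψ : ℝ → ℝ, ContDiff ℝ ∞ ψ → (∃ A, ∀ s, A ≤ s → ψ s = 0) →
      ∫ x, ψ (f x) * L x ∂μ = -∫ x, deriv ψ (f x) * g x ∂μ) (A : ℝ) {t : ℝ} (ht : 1 ≤ t) :
    ∫ x, cutoff A (f x) * ((f x / t - k) * Real.exp (-f x / t)) ∂μ ≤ 0 := by
  have ht0 : 0 < t := by linarith
  set ψ : ℝ → ℝ := fun s => cutoff A s * Real.exp (-s / t) with hψ
  have hψs : ContDiff ℝ ∞ ψ := (contDiff_cutoff A).mul (contDiff_neg.div_const t).exp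
  have hψ0 : ∀ s, A + 1 ≤ s → ψ s = 0 := fun s hs => by simp [hψ, cutoff_eq_zero hs]
  have hd : ∀ s, deriv ψ s =
      deriv (cutoff A) s * Real.exp (-s / t) - cutoff A s * Real.exp (-s / t) / t := by
    intro s
    have h1 := (((contDiff_cutoff A).differentiable (by simp)) s).hasDerivAt
    have h2 : HasDerivAt (fun s => -s / t) (-1 / t) s := (hasDerivAt_neg s).div_const t
    exact (h1.mul h2.exp).deriv.trans (by ring)
  -- `ψ` vanishes near every `s > A + 1`.
  have hψ1 : ∀ s, A + 2 ≤ s → deriv ψ s = 0 := by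
    intro s hs
    have : ψ =ᶠ[nhds s] fun _ => 0 := by
      filter_upwards [lt_mem_nhds (show A + 1 < s by linarith)] with z hz using hψ0 z hz.le
    simp [this.deriv_eq]
  have i1 := integrable_comp_mul (μ := μ) hf hK hψs.continuous hψ0 hLc
  have i2 := integrable_comp_mul (μ := μ) hf hK (hψs.continuous_deriv (by simp)) hψ1 hgc
  have i3 : Integrable (fun x => cutoff A (f x) * ((f x / t - k) * Real.exp (-f x / t))) μ :=
    integrable_comp_mul hf hK (contDiff_cutoff A).continuous
      (fun s hs => cutoff_eq_zero (A := A) hs) (by fun_prop)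
  have h0 : ∫ x, -(ψ (f x) * L x + deriv ψ (f x) * g x) ∂μ = 0 := by
    rw [integral_neg, integral_add i1 i2, hibp ψ hψs ⟨_, hψ0⟩]
    ring
  rw [← h0]
  refine integral_mono i3 (i1.add i2).neg fun x => ?_
  change _ ≤ -(ψ (f x) * L x + deriv ψ (f x) * g x)
  rw [hd]
  simp only [hψ]
  have he := (Real.exp_pos (-f x / t)).le
  have hmain : 0 ≤ k - f x / t - L x + g x / t := by
    have h1 : 0 ≤ (f x - g x) * (1 - 1 / t) :=
      mul_nonneg (by linarith [hgf x]) (by rw [sub_nonneg, div_le_one ht0]; exact ht)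
    have h2 : (f x - g x) * (1 - 1 / t) = f x - g x - f x / t + g x / t := by ring
    linarith [hL x]
  have h1 := mul_nonneg (mul_nonneg (cutoff_nonneg A (f x)) he) hmain
  have h2 := mul_nonneg (mul_nonneg (neg_nonneg.2 (deriv_cutoff_nonpos A (f x))) he) (hg0 x)
  have h3 : cutoff A (f x) * Real.exp (-f x / t) * (k - f x / t - L x + g x / t) +
      -deriv (cutoff A) (f x) * Real.exp (-f x / t) * g x =
      -(cutoff A (f x) * Real.exp (-f x / t) * L x + (deriv (cutoff A) (f x) *
        Real.exp (-f x / t) - cutoff A (f x) * Real.exp (-f x / t) / t) * g x) -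
      cutoff A (f x) * ((f x / t - k) * Real.exp (-f x / t)) := by ring
  linarith

/-- Differentiation under the integral sign; on a compact interval of times and on the support of
the cutoff the derivative of the integrand is bounded. -/
theorem hasDerivAt_integral_cutoff_mul (hf : Continuous f) (hK : ∀ A, IsCompact {x | f x ≤ A})
    (hf0 : ∀ x, 0 ≤ f x) (k A : ℝ) {t : ℝ} (ht : 0 < t) :
    HasDerivAt (fun t => ∫ x, cutoff A (f x) * (t ^ (-k) * Real.exp (-f x / t)) ∂μ)
      (∫ x, cutoff A (f x) * (t ^ (-k) * t⁻¹ * ((f x / t - k) * Real.exp (-f x / t))) ∂μ) t := by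
  have hcut := (contDiff_cutoff A).continuous
  have hint : ∀ {w : X → ℝ}, Continuous w → Integrable (fun x => cutoff A (f x) * w x) μ :=
    fun hw => integrable_comp_mul hf hK hcut (fun s hs => cutoff_eq_zero (A := A) hs) hw
  obtain ⟨B, hB⟩ := ((isCompact_Icc (a := t / 2) (b := 2 * t)).prod
    (isCompact_Icc (a := (0 : ℝ)) (b := A + 1))).exists_bound_of_continuousOn
    ((continuousOn_deriv_weight k (t / 2) (2 * t) (by linarith)).mono
      (Set.prod_mono_right (Set.subset_univ _)))
  refine (hasDerivAt_integral_of_dominated_loc_of_deriv_le (bound := fun x => cutoff A (f x) * B)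
    (F' := fun t x => cutoff A (f x) *
      (t ^ (-k) * t⁻¹ * ((f x / t - k) * Real.exp (-f x / t))))
    (s := Set.Icc (t / 2) (2 * t)) (Icc_mem_nhds (by linarith) (by linarith)) ?_ ?_ ?_ ?_ ?_ ?_).2
  · exact .of_forall fun t => (hint (by fun_prop)).aestronglyMeasurable
  · exact hint (by fun_prop)
  · exact (hint (by fun_prop)).aestronglyMeasurable
  · refine .of_forall fun x τ hτ => ?_
    rw [norm_mul, Real.norm_of_nonneg (cutoff_nonneg _ _)]
    by_cases hx : A + 1 ≤ f x
    · simp [cutoff_eq_zero hx]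
    · exact mul_le_mul_of_nonneg_left
        (hB (τ, f x) ⟨hτ, hf0 x, (not_le.1 hx).le⟩) (cutoff_nonneg _ _)
  · exact hint continuous_const
  · exact .of_forall fun x τ hτ => (hasDerivAt_rpow_neg_mul_exp k (f x)
      (by linarith [hτ.1])).const_mul _

/-- The monotonicity formula: `t^{-k} ∫ η(f) e^{-f/t}` does not exceed its value at `t = 1`. -/
theorem integral_cutoff_exp_div_le (hf : Continuous f) (hLc : Continuous L) (hgc : Continuous g)
    (hK : ∀ A, IsCompact {x | f x ≤ A}) (hg0 : ∀ x, 0 ≤ g x) (hgf : ∀ x, g x ≤ f x)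
    (hL : ∀ x, L x - g x + f x ≤ k)
    (hibp : ∀ ψ : ℝ → ℝ, ContDiff ℝ ∞ ψ → (∃ A, ∀ s, A ≤ s → ψ s = 0) →
      ∫ x, ψ (f x) * L x ∂μ = -∫ x, deriv ψ (f x) * g x ∂μ) (A : ℝ) {t : ℝ} (ht : 1 ≤ t) :
    ∫ x, cutoff A (f x) * Real.exp (-f x / t) ∂μ ≤
      t ^ k * ∫ x, cutoff A (f x) * Real.exp (-f x) ∂μ := by
  have hf0 : ∀ x, 0 ≤ f x := fun x => (hg0 x).trans (hgf x)
  have hd : ∀ τ ∈ Set.Ici (1 : ℝ), HasDerivAt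
      (fun t => ∫ x, cutoff A (f x) * (t ^ (-k) * Real.exp (-f x / t)) ∂μ)
      (∫ x, cutoff A (f x) * (τ ^ (-k) * τ⁻¹ * ((f x / τ - k) * Real.exp (-f x / τ))) ∂μ) τ :=
    fun τ hτ => hasDerivAt_integral_cutoff_mul hf hK hf0 k A (zero_lt_one.trans_le hτ)
  have hanti := antitoneOn_of_deriv_nonpos (convex_Ici (1 : ℝ))
    (fun τ hτ => (hd τ hτ).continuousAt.continuousWithinAt)
    (fun τ hτ => (hd τ (interior_subset hτ)).differentiableAt.differentiableWithinAt)
    (fun τ hτ => by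
      have hτ1 : (1 : ℝ) ≤ τ := interior_subset hτ
      have hτ0 : 0 < τ := by linarith
      rw [(hd τ (interior_subset hτ)).deriv]
      simp only [mul_left_comm (cutoff A _) (τ ^ (-k) * τ⁻¹)]
      rw [integral_const_mul]
      exact mul_nonpos_of_nonneg_of_nonpos (by positivity)
        (integral_cutoff_mul_nonpos hf hLc hgc hK hg0 hgf hL hibp A hτ1))
  have h := hanti (Set.mem_Ici.2 le_rfl) (Set.mem_Ici.2 ht) ht
  have ht0 : 0 < t := by linarith
  simp only [mul_left_comm (cutoff A _) (_ ^ (-k)), integral_const_mul, Real.one_rpow, one_mul,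
    div_one] at h
  rw [Real.rpow_neg ht0.le, inv_mul_le_iff₀ (Real.rpow_pos_of_pos ht0 k)] at h
  exact h

/-- The monotonicity formula between `t = 1` and `t = 2` bounds `∫ η(f) e^{-f}` independently of
the cutoff `η`. -/
theorem integrable_exp_neg (hf : Continuous f) (hf0 : ∀ x, 0 ≤ f x)
    (hK : ∀ A, IsCompact {x | f x ≤ A})
    (hmono : ∀ A t : ℝ, 1 ≤ t → ∫ x, cutoff A (f x) * Real.exp (-f x / t) ∂μ ≤
      t ^ k * ∫ x, cutoff A (f x) * Real.exp (-f x) ∂μ) :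
    Integrable (fun x => Real.exp (-f x)) μ := by
  -- Above the level `B` the weight `e^{-f}` is at most `2^{-k-1} e^{-f/2}`.
  obtain ⟨B, hB⟩ : ∃ B : ℝ, Real.exp (-B / 2) * 2 ^ k ≤ 1 / 2 := by
    refine ⟨-2 * Real.log (1 / 2 / 2 ^ k), ?_⟩
    have h2 : (0 : ℝ) < 2 ^ k := Real.rpow_pos_of_pos two_pos k
    rw [show -(-2 * Real.log (1 / 2 / 2 ^ k)) / 2 = Real.log (1 / 2 / 2 ^ k) by ring,
      Real.exp_log (by positivity)]
    exact (div_mul_cancel₀ _ h2.ne').le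
  have hBm : MeasurableSet {x | f x ≤ B} := (isClosed_le hf continuous_const).measurableSet
  have hint : ∀ (A : ℝ) {w : X → ℝ}, Continuous w →
      Integrable (fun x => cutoff A (f x) * w x) μ := fun A _ hw =>
    integrable_comp_mul hf hK (contDiff_cutoff A).continuous
      (fun s hs => cutoff_eq_zero (A := A) hs) hw
  have hbound : ∀ A, ∫ x, cutoff A (f x) * Real.exp (-f x) ∂μ ≤ 2 * μ.real {x | f x ≤ B} := by
    intro A
    have hi1 : Integrable ({x | f x ≤ B}.indicator fun _ => (1 : ℝ)) μ :=
      (integrable_indicator_iff hBm).2 (integrableOn_const (hK B).measure_lt_top.ne)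
    have hi2 := (hint A (w := fun x => Real.exp (-f x / 2)) (by fun_prop)).const_mul
      (Real.exp (-B / 2))
    have hle : ∫ x, cutoff A (f x) * Real.exp (-f x) ∂μ ≤
        ∫ x, ({x | f x ≤ B}.indicator (fun _ => (1 : ℝ)) x +
          Real.exp (-B / 2) * (cutoff A (f x) * Real.exp (-f x / 2))) ∂μ := by
      refine integral_mono (hint A (by fun_prop)) (hi1.add hi2) fun x => ?_
      have hc0 := cutoff_nonneg A (f x)
      have hc1 := cutoff_le_one A (f x)
      by_cases hx : f x ≤ B
      · simp only [Set.indicator_of_mem (show x ∈ {x | f x ≤ B} from hx)]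
        have h1 : Real.exp (-f x) ≤ 1 := Real.exp_le_one_iff.2 (by linarith [hf0 x])
        have h2 : cutoff A (f x) * Real.exp (-f x) ≤ 1 :=
          mul_le_one₀ hc1 (Real.exp_pos _).le h1
        have : 0 ≤ Real.exp (-B / 2) * (cutoff A (f x) * Real.exp (-f x / 2)) := by positivity
        linarith
      · simp only [Set.indicator_of_notMem (show x ∉ {x | f x ≤ B} from hx), zero_add]
        have h1 : Real.exp (-f x) ≤ Real.exp (-B / 2) * Real.exp (-f x / 2) := by
          rw [← Real.exp_add]
          exact Real.exp_le_exp.2 (by linarith)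
        calc _ ≤ cutoff A (f x) * (Real.exp (-B / 2) * Real.exp (-f x / 2)) :=
              mul_le_mul_of_nonneg_left h1 hc0
          _ = _ := by ring
    rw [integral_add hi1 hi2, integral_indicator_const _ hBm, integral_const_mul, smul_eq_mul,
      mul_one] at hle
    have h2 := mul_le_mul_of_nonneg_left (hmono A 2 one_le_two) (Real.exp_pos (-B / 2)).le
    have h3 : 0 ≤ ∫ x, cutoff A (f x) * Real.exp (-f x) ∂μ :=
      integral_nonneg fun x => mul_nonneg (cutoff_nonneg _ _) (Real.exp_pos _).le
    have h4 := mul_le_mul_of_nonneg_right hB h3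
    rw [mul_assoc] at h4
    linarith
  have hcover : AECover μ Filter.atTop fun A : ℕ => {x | f x ≤ A} := by
    refine ⟨.of_forall fun x => ?_, fun A => (isClosed_le hf continuous_const).measurableSet⟩
    obtain ⟨N, hN⟩ := exists_nat_ge (f x)
    filter_upwards [Filter.eventually_ge_atTop N] with A hA
    exact hN.trans (Nat.cast_le.2 hA)
  refine hcover.integrable_of_integral_bounded_of_nonneg_ae (2 * μ.real {x | f x ≤ B})
    (fun A => (Real.continuous_exp.comp hf.neg).continuousOn.integrableOn_compact (hK A))
    (.of_forall fun x => (Real.exp_pos _).le) (.of_forall fun A => ?_)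
  refine le_trans ?_ (hbound A)
  have hAm : MeasurableSet {x | f x ≤ (A : ℝ)} := (isClosed_le hf continuous_const).measurableSet
  refine le_trans (le_of_eq ?_) (setIntegral_le_integral (s := {x | f x ≤ (A : ℝ)})
    (hint A (w := fun x => Real.exp (-f x)) (by fun_prop))
    (.of_forall fun x => mul_nonneg (cutoff_nonneg _ _) (Real.exp_pos _).le))
  refine setIntegral_congr_fun hAm fun x hx => ?_
  simp only [cutoff_eq_one (show f x ≤ A from hx), one_mul]

/-- The volume bound, from the monotonicity formula at `t = r²`. -/
theorem measure_sublevel_le (hf : Continuous f) (hf0 : ∀ x, 0 ≤ f x)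
    (hK : ∀ A, IsCompact {x | f x ≤ A})
    (hmono : ∀ A t : ℝ, 1 ≤ t → ∫ x, cutoff A (f x) * Real.exp (-f x / t) ∂μ ≤
      t ^ k * ∫ x, cutoff A (f x) * Real.exp (-f x) ∂μ)
    (hexp : Integrable (fun x => Real.exp (-f x)) μ) {r : ℝ} (hr : 1 ≤ r) :
    μ (sublevel f r) ≤
      ENNReal.ofReal (Real.exp (1 / 4) * (∫ x, Real.exp (-f x) ∂μ) * r ^ (2 * k)) := by
  have hr0 : 0 < r := by linarith
  have hsub : ∀ x ∈ sublevel f r, f x ≤ r ^ 2 / 4 := by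
    intro x hx
    have h1 : 2 * √(f x) < r := hx
    have h2 := Real.sq_sqrt (hf0 x)
    have h3 := Real.sqrt_nonneg (f x)
    nlinarith
  have hDm : MeasurableSet (sublevel f r) :=
    (isOpen_lt (continuous_const.mul hf.sqrt) continuous_const).measurableSet
  have hfin : μ (sublevel f r) ≠ ⊤ :=
    ((measure_mono hsub).trans_lt (hK (r ^ 2 / 4)).measure_lt_top).ne
  have hint : ∀ {w : X → ℝ}, Continuous w →
      Integrable (fun x => cutoff (r ^ 2 / 4) (f x) * w x) μ := fun hw =>
    integrable_comp_mul hf hK (contDiff_cutoff _).continuous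
      (fun s hs => cutoff_eq_zero hs) hw
  rw [← ofReal_measureReal hfin]
  refine ENNReal.ofReal_le_ofReal ?_
  -- On `D_r` one has `f < r²/4`, so the weight `e^{-f/r²}` is at least `e^{-1/4}` there.
  have h1 : Real.exp (-(1 / 4)) * μ.real (sublevel f r) ≤
      ∫ x, cutoff (r ^ 2 / 4) (f x) * Real.exp (-f x / r ^ 2) ∂μ := by
    rw [mul_comm, ← smul_eq_mul, ← integral_indicator_const _ hDm]
    refine integral_mono ((integrable_indicator_iff hDm).2 (integrableOn_const hfin))
      (hint (by fun_prop)) fun x => ?_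
    by_cases hx : x ∈ sublevel f r
    · simp only [Set.indicator_of_mem hx, cutoff_eq_one (hsub x hx), one_mul]
      refine Real.exp_le_exp.2 ?_
      rw [neg_div, neg_le_neg_iff, div_le_iff₀ (by positivity)]
      linarith [hsub x hx]
    · simp only [Set.indicator_of_notMem hx]
      exact mul_nonneg (cutoff_nonneg _ _) (Real.exp_pos _).le
  have h2 := hmono (r ^ 2 / 4) (r ^ 2) (one_le_pow₀ hr)
  have h3 : ∫ x, cutoff (r ^ 2 / 4) (f x) * Real.exp (-f x) ∂μ ≤ ∫ x, Real.exp (-f x) ∂μ :=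
    integral_mono (hint (by fun_prop)) hexp fun x =>
      mul_le_of_le_one_left (Real.exp_pos _).le (cutoff_le_one _ _)
  have h4 : (r ^ 2) ^ k = r ^ (2 * k) := by
    rw [Real.rpow_mul hr0.le, Real.rpow_two]
  rw [h4] at h2
  have h5 := (h1.trans h2).trans
    (mul_le_mul_of_nonneg_left h3 (Real.rpow_pos_of_pos hr0 (2 * k)).le)
  have h6 := mul_le_mul_of_nonneg_left h5 (Real.exp_pos (1 / 4)).le
  rw [← mul_assoc, ← Real.exp_add, add_neg_cancel, Real.exp_zero, one_mul] at h6
  linarith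

end WeightedMonotonicity

/-! ### Green's formula for functions of `f`, and the volume bound -/

section SublevelVolume

variable {n : ℕ} {M : Type*} [TopologicalSpace M] [ChartedSpace (EuclideanSpace ℝ (Fin n)) M]
  [RiemannianBundle (fun x : M => TangentSpace (𝓡 n) x)]

theorem mvfderiv_grad (f : M → ℝ) (x : M) :
    mvfderiv (𝓡 n) f x (grad (n := n) f x) = ‖grad (n := n) f x‖ ^ 2 := by
  rw [← inner_grad, real_inner_self_eq_norm_sq]

theorem mvfderiv_comp_grad {ψ : ℝ → ℝ} {f : M → ℝ} {x : M} (hψ : DifferentiableAt ℝ ψ (f x))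
    (hf : MDifferentiableAt (𝓡 n) 𝓘(ℝ, ℝ) f x) :
    mvfderiv (𝓡 n) (ψ ∘ f) x (grad (n := n) f x) =
      deriv ψ (f x) * ‖grad (n := n) f x‖ ^ 2 := by
  rw [← mvfderiv_grad, mvfderiv_comp_apply x hψ.mdifferentiableAt hf, mul_comm, ← smul_eq_mul]
  have h1 : mvfderiv 𝓘(ℝ, ℝ) ψ (f x) = fderiv ℝ ψ (f x) := mfderiv_eq_fderiv
  rw [h1]
  exact fderiv_eq_smul_deriv _

variable [IsManifold (𝓡 n) ∞ M]
  [IsContMDiffRiemannianBundle (𝓡 n) ∞ (EuclideanSpace ℝ (Fin n))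
    (fun x : M => TangentSpace (𝓡 n) x)]
  [T2Space M] [SecondCountableTopology M] [MeasurableSpace M] [BorelSpace M]

omit [T2Space M] [SecondCountableTopology M] [MeasurableSpace M] [BorelSpace M] in
theorem hasSmoothComponents_grad {f : M → ℝ} (hf : ContMDiff (𝓡 n) 𝓘(ℝ, ℝ) ∞ f) :
    HasSmoothComponents (grad (n := n) f) :=
  fun c i => contDiffOn_chartComponent_grad c hf i

/-- Green's formula `∫ ψ(f) Δf dv = -∫ ψ'(f) |∇f|² dv`. -/
theorem integral_comp_mul_laplacian {f : M → ℝ} (hf : ContMDiff (𝓡 n) 𝓘(ℝ, ℝ) ∞ f)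
    (hK : ∀ A, IsCompact {x | f x ≤ A}) {ψ : ℝ → ℝ} (hψ : ContDiff ℝ ∞ ψ) {A : ℝ}
    (hA : ∀ s, A ≤ s → ψ s = 0) :
    ∫ x, ψ (f x) * laplacian (n := n) f x ∂(riemannianVolume n M) =
      -∫ x, deriv ψ (f x) * ‖grad (n := n) f x‖ ^ 2 ∂(riemannianVolume n M) := by
  have hc : HasCompactSupport (ψ ∘ f) := HasCompactSupport.intro (hK A) fun x hx =>
    hA _ (not_le.1 hx).le
  refine (integral_mul_divergence (hasSmoothComponents_grad hf)
    (hψ.contMDiff.comp hf) hc).trans ?_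
  congr 1
  refine integral_congr_ae (.of_forall fun x => ?_)
  exact mvfderiv_comp_grad (hψ.differentiable (by simp) _) ((hf x).mdifferentiableAt (by simp))

end SublevelVolume

end RiemannianVolumeGrowth

open RiemannianVolumeGrowth

theorem theorem2p1 :
    ∃ C : ℝ → ℝ,
      ∀ (n : ℕ) (M : Type*) [EMetricSpace M] [CompleteSpace M] [NoncompactSpace M]
        [MeasurableSpace M] [BorelSpace M]
        [ChartedSpace (EuclideanSpace ℝ (Fin n)) M] [IsManifold (𝓡 n) ∞ M]
        [RiemannianBundle (fun x : M => TangentSpace (𝓡 n) x)]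
        [IsContMDiffRiemannianBundle (𝓡 n) ∞ (EuclideanSpace ℝ (Fin n))
          (fun x : M => TangentSpace (𝓡 n) x)]
        [IsRiemannianManifold (𝓡 n) M]
        (f : M → ℝ) (k : ℝ),
        ContMDiff (𝓡 n) 𝓘(ℝ, ℝ) ∞ f →
        IsProperMap f →
        (∀ x : M, ‖RiemannianVolumeGrowth.grad (n := n) f x‖ ^ 2 ≤ f x) →
        (∀ x : M, RiemannianVolumeGrowth.laplacian (n := n) f x
          - ‖RiemannianVolumeGrowth.grad (n := n) f x‖ ^ 2 + f x ≤ k) →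
        Integrable (fun x => Real.exp (-f x)) (RiemannianVolumeGrowth.riemannianVolume n M) ∧
        ∀ r : ℝ, 1 ≤ r →
          RiemannianVolumeGrowth.riemannianVolume n M (RiemannianVolumeGrowth.sublevel f r) ≤
            ENNReal.ofReal
              (C (∫ x, Real.exp (-f x) ∂(RiemannianVolumeGrowth.riemannianVolume n M))
                * r ^ (2 * k)) := by

  refine ⟨fun I => Real.exp (1 / 4) * I, ?_⟩
  intro n M _ _ _ _ _ _ _ _ _ _ f k hf hprop hgrad hlap
  have hf0 : ∀ x, 0 ≤ f x := fun x => (sq_nonneg _).trans (hgrad x)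
  have hK : ∀ A, IsCompact {x | f x ≤ A} := fun A => by
    convert! hprop.isCompact_preimage (isCompact_Icc (a := 0) (b := A)) using 1
    ext x
    simp [hf0 x]
  -- The compact sublevel sets of `f` exhaust `M`.
  have : SigmaCompactSpace M := by
    refine ⟨fun m : ℕ => {x | f x ≤ m}, fun m => hK m, ?_⟩
    refine Set.eq_univ_of_forall fun x => Set.mem_iUnion.2 ?_
    exact exists_nat_ge (f x)
  have := ChartedSpace.secondCountable_of_sigmaCompact (EuclideanSpace ℝ (Fin n)) M
  have hX := hasSmoothComponents_grad (n := n) hf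
  have hL : Continuous (laplacian (n := n) f) := continuous_divergence hX
  have hg : Continuous fun x => ‖grad (n := n) f x‖ ^ 2 :=
    (continuous_mvfderiv_apply hX hf).congr fun x => mvfderiv_grad f x
  have hmono := fun A t ht => integral_cutoff_exp_div_le (μ := riemannianVolume n M)
    hf.continuous hL hg hK (fun x => sq_nonneg _) hgrad hlap
    (fun ψ hψ ⟨_, hA⟩ => integral_comp_mul_laplacian hf hK hψ hA) A (t := t) ht
  have hint := integrable_exp_neg hf.continuous hf0 hK hmono
  exact ⟨hint, fun r hr => measure_sublevel_le hf.continuous hf0 hK hmono hint hr⟩
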